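/- Throughout, Huber pairs $(A,A^+)$ are complete (and Hausdorff), analytic (the topologically nilpotent elements of $A$ generate the unit ideal) and, for the source and target of the morphism below, uniform (the set of power-bounded elements is bounded). A pair $(A,A^+)$ is \emph{strongly sheafy} if $(A\langle X_1,\dots,X_n\rangle, A^+\langle X_1,\dots,X_n\rangle)$ is sheafy for every $n\ge 0$. A morphism $f:(A,A^+)\to(B,B^+)$ is \emph{naive étale} if $(A,A^+)$ and $(B,B^+)$ are strongly sheafy and there is a finite covering of $\mathrm{Spa}(B,B^+)$ by rational subsets, with rings of sections $(B_j,B_j^+)$, such that each composite $A\to B\to B_j$ is a finite composite of rational localizations and finite étale morphisms. Let $A\to B$ be of topologically finite type: $B=P/I$ with $P=A\langle X_1,\dots,X_n\rangle_{T_1,\dots,T_n}$, where the $T_i\subset A$ are finite subsets with $T_iA=A$, the map $P\to B$ is a continuous open surjection and $I$ is its (closed) kernel. The truncated topological cotangent complex is the two-term complex of complete modules $$\tau_{\le 1}\mathbb L_{B/A,\mathrm{topo}}=\Bigl[\,I/\overline{I^2}\longrightarrow \Omega^1/I\Omega^1=\bigoplus_{i=1}^n B\,dX_i\,\Bigr],\qquad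 f\mapsto df=\sum_i \frac{\partial f}{\partial X_i}\,dX_i,$$ where $\Omega^1=\bigoplus_i P\,dX_i$ and $\overline{I^2}$ is the closure of $I^2$ (so $I/\overline{I^2}$ is the completion of $I/I^2$). \textbf{Lemma.} Let $f:(A,A^+)\to(B,B^+)$ be a naive étale morphism. Then $\tau_{\le 1}\mathbb L_{B/A,\mathrm{topo}}$ is quasi-isomorphic to zero locally for the rational topology: there is a finite covering of $\mathrm{Spa}(B,B^+)$ by rational subsets, with rings of sections $(B_j,B_j^+)$, such that every $B_j$ is of topologically finite type over $A$ and, for every presentation of $B_j$ over $A$ as above, the complex $\tau_{\le 1}\mathbb L_{B_j/A,\mathrm{topo}}$ is quasi-isomorphic to zero. -/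

import Mathlib

open scoped Topology Pointwise

universe u

set_option linter.unusedSectionVars false

namespace NaiveEtale

section RestrictedPowerSeries

variable {A : Type u} [CommRing A]

/-- A family `T₁, …, Tₙ` of finite subsets of `A`, each generating the unit ideal. (In an analytic
ring the unit ideal is the only open ideal, so this is the usual requirement that the ideals
`Tᵢ · A` be open.) -/
structure Weights (A : Type u) [CommRing A] (n : ℕ) where
  set : Fin n → Finset A
  span_eq_top : ∀ i, Ideal.span (set i : Set A) = ⊤

/-- The trivial weights `Tᵢ = {1}`. -/
def Weights.one (A : Type u) [CommRing A] (n : ℕ) : Weights A n where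
  set _ := {1}
  span_eq_top _ := by simp

/-- The additive subgroup `T^ν` of `A` generated by all products of `ν₁` elements of `T₁`, …,
`νₙ` elements of `Tₙ`. Then `T.pow ν * U` is the additive subgroup `T^ν · U`. -/
noncomputable def Weights.pow {n : ℕ} (T : Weights A n) (ν : Fin n →₀ ℕ) : Submodule ℤ A :=
  ∏ i, Submodule.span ℤ (T.set i : Set A) ^ ν i

lemma Weights.pow_zero {n : ℕ} (T : Weights A n) : T.pow 0 = 1 := by
  simp [Weights.pow]

lemma Weights.pow_add {n : ℕ} (T : Weights A n) (μ ν : Fin n →₀ ℕ) :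
    T.pow (μ + ν) = T.pow μ * T.pow ν := by
  simp [Weights.pow, _root_.pow_add, Finset.prod_mul_distrib]

lemma Weights.pow_single {n : ℕ} (T : Weights A n) (i : Fin n) :
    T.pow (Finsupp.single i 1) = Submodule.span ℤ (T.set i : Set A) := by
  rw [Weights.pow, Finset.prod_eq_single i]
  · simp
  · intro j _ hj
    simp [Finsupp.single_eq_of_ne hj]
  · simp

variable [TopologicalSpace A]

/-- Open additive subgroups of `A`. -/
abbrev OpenSubmod (A : Type u) [CommRing A] [TopologicalSpace A] :=
  {U : Submodule ℤ A // IsOpen (U : Set A)}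

instance : Nonempty (OpenSubmod A) := ⟨⟨⊤, by simp⟩⟩

variable [NonarchimedeanRing A]

lemma exists_openSubmod {S : Set A} (hS : S ∈ 𝓝 (0 : A)) :
    ∃ U : OpenSubmod A, (U.1 : Set A) ⊆ S := by
  obtain ⟨V, hV⟩ := NonarchimedeanRing.is_nonarchimedean S hS
  exact ⟨⟨AddSubgroup.toIntSubmodule V.toAddSubgroup, V.isOpen⟩, hV⟩

lemma OpenSubmod.mem_nhds (U : OpenSubmod A) : (U.1 : Set A) ∈ 𝓝 (0 : A) :=
  U.2.mem_nhds U.1.zero_mem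

lemma isOpen_of_mem_nhds {M : Submodule ℤ A} (h : (M : Set A) ∈ 𝓝 (0 : A)) :
    IsOpen (M : Set A) :=
  AddSubgroup.isOpen_of_mem_nhds M.toAddSubgroup (g := 0) h

lemma exists_mul_le (a : A) (U : OpenSubmod A) :
    ∃ V : OpenSubmod A, ∀ v ∈ V.1, a * v ∈ U.1 := by
  have h : Filter.Tendsto (fun x : A => a * x) (𝓝 0) (𝓝 0) := by
    simpa using (continuous_const_mul a).tendsto (0 : A)
  obtain ⟨V, hV⟩ := exists_openSubmod (h U.mem_nhds)
  exact ⟨V, fun v hv => hV hv⟩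

lemma exists_forall_mul_le {ι : Type*} (s : Finset ι) (a : ι → A) (U : ι → OpenSubmod A) :
    ∃ V : OpenSubmod A, ∀ i ∈ s, ∀ v ∈ V.1, a i * v ∈ (U i).1 := by
  choose V hV using fun i => exists_mul_le (a i) (U i)
  have h : (⋂ i ∈ s, ((V i).1 : Set A)) ∈ 𝓝 (0 : A) :=
    (Filter.biInter_finset_mem s).2 fun i _ => (V i).mem_nhds
  obtain ⟨W, hW⟩ := exists_openSubmod h
  refine ⟨W, fun i hi v hv => hV i v ?_⟩
  have := hW hv
  simp only [Set.mem_iInter] at this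
  exact this i hi

lemma exists_mul_self_le (U : OpenSubmod A) : ∃ V : OpenSubmod A, V.1 * V.1 ≤ U.1 := by
  have h : Filter.Tendsto (fun x : A × A => x.1 * x.2) (𝓝 0 ×ˢ 𝓝 0) (𝓝 0) := by
    simpa [nhds_prod_eq] using (continuous_mul (M := A)).tendsto (0, 0)
  obtain ⟨S, hS, S', hS', h⟩ := Filter.mem_prod_iff.1 (h U.mem_nhds)
  obtain ⟨V, hV⟩ := exists_openSubmod (Filter.inter_mem hS hS')
  exact ⟨V, Submodule.mul_le.2 fun a ha b hb =>
    h (Set.mk_mem_prod (hV ha).1 (hV hb).2)⟩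

/-- `M · U` is open whenever `U` is. -/
def PreservesOpen (M : Submodule ℤ A) : Prop :=
  ∀ U : OpenSubmod A, IsOpen ((M * U.1 : Submodule ℤ A) : Set A)

lemma PreservesOpen.one : PreservesOpen (1 : Submodule ℤ A) := fun U => by
  rw [one_mul]; exact U.2

lemma PreservesOpen.mul {M N : Submodule ℤ A} (hM : PreservesOpen M) (hN : PreservesOpen N) :
    PreservesOpen (M * N) := fun U => by
  rw [mul_assoc]; exact hM ⟨_, hN U⟩

lemma PreservesOpen.pow {M : Submodule ℤ A} (hM : PreservesOpen M) (k : ℕ) :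
    PreservesOpen (M ^ k) := by
  induction k with
  | zero => rw [_root_.pow_zero]; exact .one
  | succ k ih => rw [_root_.pow_succ]; exact ih.mul hM

lemma preservesOpen_span {T : Finset A} (hT : Ideal.span (T : Set A) = ⊤) :
    PreservesOpen (Submodule.span ℤ (T : Set A)) := fun U => by
  obtain ⟨c, -, hc⟩ := Submodule.mem_span_finset.1
    (show (1 : A) ∈ Submodule.span A (T : Set A) from by
      have : (1 : A) ∈ Ideal.span (T : Set A) := by rw [hT]; trivial
      exact this)
  obtain ⟨V, hV⟩ := exists_forall_mul_le T c (fun _ => U)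
  refine isOpen_of_mem_nhds (Filter.mem_of_superset V.mem_nhds fun x hx => ?_)
  have hx' : x = ∑ t ∈ T, t * (c t * x) := by
    conv_lhs => rw [← one_mul x, ← hc, Finset.sum_mul]
    exact Finset.sum_congr rfl fun t _ => by simp only [smul_eq_mul]; ring
  rw [hx']
  exact Submodule.sum_mem _ fun t ht =>
    Submodule.mul_mem_mul (Submodule.subset_span ht) (hV t ht x hx)

lemma Weights.preservesOpen {n : ℕ} (T : Weights A n) (ν : Fin n →₀ ℕ) :
    PreservesOpen (T.pow ν) :=
  Finset.prod_induction _ PreservesOpen (fun _ _ h h' => h.mul h') .one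
    fun i _ => (preservesOpen_span (T.span_eq_top i)).pow _

lemma mul_mem_aux {M N R U : Submodule ℤ A} {a b : A} (hb : b ∈ N * R)
    (h : ∀ v ∈ R, a * v ∈ M * U) : a * b ∈ (M * N) * U := by
  induction hb using Submodule.mul_induction_on' with
  | mem_mul_mem x hx y hy =>
    have : a * (x * y) = x * (a * y) := by ring
    rw [this, mul_comm M N, mul_assoc]
    exact Submodule.mul_mem_mul hx (h y hy)
  | add x _ y _ hx hy => rw [mul_add]; exact Submodule.add_mem _ hx hy

/-- The coefficients `a_ν` eventually lie in `T^ν · U`, for every open subgroup `U`. -/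
def IsRestricted {n : ℕ} (T : Weights A n) (p : MvPowerSeries (Fin n) A) : Prop :=
  ∀ U : OpenSubmod A, ∀ᶠ ν in Filter.cofinite, MvPowerSeries.coeff ν p ∈ T.pow ν * U.1

lemma restricted_mul {n : ℕ} (T : Weights A n) {p q : MvPowerSeries (Fin n) A}
    (hp : IsRestricted T p) (hq : IsRestricted T q) : IsRestricted T (p * q) := by
  classical
  intro U
  obtain ⟨V, hV⟩ := exists_mul_self_le U
  have hF : {μ | MvPowerSeries.coeff μ p ∉ T.pow μ * V.1}.Finite := hp V
  have hG : {μ | MvPowerSeries.coeff μ q ∉ T.pow μ * V.1}.Finite := hq V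
  obtain ⟨W, hW⟩ := exists_forall_mul_le hF.toFinset (fun μ => MvPowerSeries.coeff μ p)
    (fun μ => ⟨_, T.preservesOpen μ U⟩)
  obtain ⟨W', hW'⟩ := exists_forall_mul_le hG.toFinset (fun μ => MvPowerSeries.coeff μ q)
    (fun μ => ⟨_, T.preservesOpen μ U⟩)
  have hF' : {μ | MvPowerSeries.coeff μ p ∉ T.pow μ * W'.1}.Finite := hp W'
  have hG' : {μ | MvPowerSeries.coeff μ q ∉ T.pow μ * W.1}.Finite := hq W
  refine ((hF.union hF').add (hG.union hG')).subset fun ν hν => ?_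
  by_contra hcon
  apply hν
  change MvPowerSeries.coeff ν (p * q) ∈ T.pow ν * U.1
  rw [MvPowerSeries.coeff_mul]
  refine Submodule.sum_mem _ fun x hx => ?_
  have hx' : x.1 + x.2 = ν := by simpa using hx
  rw [← hx', T.pow_add]
  by_cases h1 : MvPowerSeries.coeff x.1 p ∈ T.pow x.1 * V.1
  · by_cases h2 : MvPowerSeries.coeff x.2 q ∈ T.pow x.2 * V.1
    · have := Submodule.mul_mem_mul h1 h2
      rw [mul_mul_mul_comm] at this
      exact mul_le_mul' le_rfl hV this
    · have h3 : MvPowerSeries.coeff x.1 p ∈ T.pow x.1 * W'.1 := by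
        by_contra h3
        exact hcon (hx' ▸ Set.add_mem_add (Or.inr h3) (Or.inl h2))
      have := mul_mem_aux h3 (hW' x.2 (hG.mem_toFinset.2 h2))
      rw [mul_comm (T.pow x.1), mul_comm (MvPowerSeries.coeff x.1 p)]
      exact this
  · have h3 : MvPowerSeries.coeff x.2 q ∈ T.pow x.2 * W.1 := by
      by_contra h3
      exact hcon (hx' ▸ Set.add_mem_add (Or.inl h1) (Or.inr h3))
    exact mul_mem_aux h3 (hW x.1 (hF.mem_toFinset.2 h1))

/-- The ring `A⟨X₁, …, Xₙ⟩_{T₁, …, Tₙ}` of formal power series `∑ a_ν X^ν` such that for every open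
subgroup `U` of `A` one has `a_ν ∈ T^ν · U` for all but finitely many `ν`. -/
def restricted {n : ℕ} (T : Weights A n) : Subring (MvPowerSeries (Fin n) A) where
  carrier := {p | IsRestricted T p}
  zero_mem' U := by simp
  one_mem' U := by
    classical
    refine (Set.finite_singleton (0 : Fin n →₀ ℕ)).subset fun ν hν => ?_
    by_contra h
    apply hν
    change MvPowerSeries.coeff ν (1 : MvPowerSeries (Fin n) A) ∈ T.pow ν * U.1
    rw [MvPowerSeries.coeff_one, if_neg (by simpa using h)]
    exact Submodule.zero_mem _
  add_mem' {p q} hp hq U := by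
    filter_upwards [hp U, hq U] with ν h h'
    rw [map_add]
    exact Submodule.add_mem _ h h'
  neg_mem' {p} hp U := by
    filter_upwards [hp U] with ν h
    rw [map_neg]
    exact Submodule.neg_mem _ h
  mul_mem' hp hq := restricted_mul T hp hq

variable {n : ℕ} (T : Weights A n)

/-- The subgroup `U⟨X⟩_T` of all `∑ a_ν X^ν` with `a_ν ∈ T^ν · U` for all `ν`. -/
def restrictedNhd (U : OpenSubmod A) : AddSubgroup (restricted T) where
  carrier := {p | ∀ ν, MvPowerSeries.coeff ν p.1 ∈ T.pow ν * U.1}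
  zero_mem' ν := by simp
  add_mem' {p q} hp hq ν := by
    simpa using Submodule.add_mem _ (hp ν) (hq ν)
  neg_mem' {p} hp ν := by
    simpa using hp ν

variable {T} in
lemma mem_restrictedNhd {U : OpenSubmod A} {p : restricted T} :
    p ∈ restrictedNhd T U ↔ ∀ ν, MvPowerSeries.coeff ν p.1 ∈ T.pow ν * U.1 := Iff.rfl

lemma exists_restrictedNhd_mul_le (p : restricted T) (U : OpenSubmod A) :
    ∃ V, ∀ q ∈ restrictedNhd T V, p * q ∈ restrictedNhd T U := by
  classical
  obtain ⟨V, hV⟩ := exists_mul_self_le U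
  have hF : {μ | MvPowerSeries.coeff μ p.1 ∉ T.pow μ * V.1}.Finite := p.2 V
  obtain ⟨W, hW⟩ := exists_forall_mul_le hF.toFinset (fun μ => MvPowerSeries.coeff μ p.1)
    (fun μ => ⟨_, T.preservesOpen μ U⟩)
  obtain ⟨W', hW'⟩ := exists_openSubmod (Filter.inter_mem V.mem_nhds W.mem_nhds)
  refine ⟨W', fun q hq ν => ?_⟩
  change MvPowerSeries.coeff ν (p.1 * q.1) ∈ T.pow ν * U.1
  rw [MvPowerSeries.coeff_mul]
  refine Submodule.sum_mem _ fun x hx => ?_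
  have hx' : x.1 + x.2 = ν := by simpa using hx
  rw [← hx', T.pow_add]
  by_cases h1 : MvPowerSeries.coeff x.1 p.1 ∈ T.pow x.1 * V.1
  · have := Submodule.mul_mem_mul h1 (hq x.2)
    rw [mul_mul_mul_comm] at this
    exact mul_le_mul' le_rfl
      ((mul_le_mul' le_rfl fun v hv => (hW' hv).1).trans hV) this
  · exact mul_mem_aux (hq x.2)
      fun v hv => hW x.1 (hF.mem_toFinset.2 h1) v (hW' hv).2

lemma restricted_basis : RingSubgroupsBasis (restrictedNhd T) := by
  refine RingSubgroupsBasis.of_comm _ (fun U V => ?_) (fun U => ?_) fun p U => ?_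
  · obtain ⟨W, hW⟩ := exists_openSubmod (Filter.inter_mem U.mem_nhds V.mem_nhds)
    exact ⟨W, fun p hp =>
      ⟨fun ν => mul_le_mul' (le_refl (T.pow ν)) (show W.1 ≤ U.1 from fun v hv => (hW hv).1) (hp ν),
        fun ν => mul_le_mul' (le_refl (T.pow ν)) (show W.1 ≤ V.1 from fun v hv => (hW hv).2)
          (hp ν)⟩⟩
  · obtain ⟨V, hV⟩ := exists_mul_self_le U
    refine ⟨V, ?_⟩
    rintro _ ⟨p, hp, q, hq, rfl⟩ ν
    change MvPowerSeries.coeff ν (p.1 * q.1) ∈ T.pow ν * U.1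
    classical
    rw [MvPowerSeries.coeff_mul]
    refine Submodule.sum_mem _ fun x hx => ?_
    have hx' : x.1 + x.2 = ν := by simpa using hx
    rw [← hx', T.pow_add]
    have := Submodule.mul_mem_mul (hp x.1) (hq x.2)
    rw [mul_mul_mul_comm] at this
    exact mul_le_mul' le_rfl hV this
  · obtain ⟨V, hV⟩ := exists_restrictedNhd_mul_le T p U
    exact ⟨V, fun q hq => hV q hq⟩

/-- The topology of `A⟨X⟩_T`: the subgroups `U⟨X⟩_T` form a basis of neighbourhoods of `0`. -/
noncomputable instance : TopologicalSpace (restricted T) := (restricted_basis T).topology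

instance : NonarchimedeanRing (restricted T) := (restricted_basis T).nonarchimedean

lemma restricted_hasBasis :
    (𝓝 (0 : restricted T)).HasBasis (fun _ => True) fun U => (restrictedNhd T U : Set _) :=
  (restricted_basis T).hasBasis_nhds_zero

/-- The constant power series, as a ring homomorphism `A → A⟨X⟩_T`. -/
noncomputable def const : A →+* restricted T :=
  (MvPowerSeries.C (σ := Fin n) (R := A)).codRestrict (restricted T) fun a U => by
    classical
    refine (Set.finite_singleton (0 : Fin n →₀ ℕ)).subset fun ν hν => ?_
    by_contra h
    apply hν
    change MvPowerSeries.coeff ν (MvPowerSeries.C a) ∈ T.pow ν * U.1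
    rw [MvPowerSeries.coeff_C, if_neg (by simpa using h)]
    exact Submodule.zero_mem _

/-- The variable `Xᵢ`, as an element of `A⟨X⟩_T`. -/
noncomputable def var (i : Fin n) : restricted T :=
  ⟨MvPowerSeries.X i, fun U => by
    classical
    refine (Set.finite_singleton (Finsupp.single i 1 : Fin n →₀ ℕ)).subset fun ν hν => ?_
    by_contra h
    apply hν
    change MvPowerSeries.coeff ν (MvPowerSeries.X i : MvPowerSeries (Fin n) A) ∈ T.pow ν * U.1
    rw [MvPowerSeries.coeff_X, if_neg (by simpa using h)]
    exact Submodule.zero_mem _⟩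

lemma exists_span_mul_le (i : Fin n) (U : OpenSubmod A) :
    ∃ V : OpenSubmod A, Submodule.span ℤ (T.set i : Set A) * V.1 ≤ U.1 := by
  obtain ⟨V, hV⟩ := exists_forall_mul_le (T.set i) id (fun _ => U)
  refine ⟨V, ?_⟩
  rw [← Submodule.span_eq V.1, Submodule.span_mul_span, Submodule.span_le]
  rintro _ ⟨t, ht, v, hv, rfl⟩
  exact hV t ht v hv

lemma coeff_pderiv_mem {i : Fin n} {U V : OpenSubmod A}
    (hV : Submodule.span ℤ (T.set i : Set A) * V.1 ≤ U.1) {p : MvPowerSeries (Fin n) A}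
    {ν : Fin n →₀ ℕ} (h : MvPowerSeries.coeff (ν + Finsupp.single i 1) p ∈
      T.pow (ν + Finsupp.single i 1) * V.1) :
    MvPowerSeries.coeff ν (MvPowerSeries.pderiv A i p) ∈ T.pow ν * U.1 := by
  rw [T.pow_add, T.pow_single, mul_assoc] at h
  have h' := mul_le_mul' le_rfl hV h
  have := Submodule.smul_mem _ ((ν i : ℤ) + 1) h'
  rw [MvPowerSeries.coeff_pderiv]
  simpa [zsmul_eq_mul, mul_comm (MvPowerSeries.coeff (ν + Finsupp.single i 1) p)] using this

/-- The partial derivative `∂/∂Xᵢ` on `A⟨X⟩_T`. -/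
noncomputable def partialDeriv (i : Fin n) (p : restricted T) : restricted T :=
  ⟨MvPowerSeries.pderiv A i p.1, fun U => by
    obtain ⟨V, hV⟩ := exists_span_mul_le T i U
    have hinj : Function.Injective fun ν : Fin n →₀ ℕ => ν + Finsupp.single i 1 :=
      add_left_injective _
    filter_upwards [hinj.tendsto_cofinite.eventually (p.2 V)] with ν hν
    exact coeff_pderiv_mem T hV hν⟩

lemma partialDeriv_add (i : Fin n) (p q : restricted T) :
    partialDeriv T i (p + q) = partialDeriv T i p + partialDeriv T i q :=
  Subtype.ext (by simp [partialDeriv])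

lemma partialDeriv_mul (i : Fin n) (p q : restricted T) :
    partialDeriv T i (p * q) = p * partialDeriv T i q + q * partialDeriv T i p :=
  Subtype.ext (by simp [partialDeriv, Derivation.leibniz])

lemma continuous_partialDeriv (i : Fin n) : Continuous (partialDeriv T i) := by
  let f : restricted T →+ restricted T := AddMonoidHom.mk' _ (partialDeriv_add T i)
  refine continuous_of_continuousAt_zero f ?_
  unfold ContinuousAt
  rw [map_zero]
  refine ((restricted_hasBasis T).tendsto_iff (restricted_hasBasis T)).2 fun U _ => ?_
  obtain ⟨V, hV⟩ := exists_span_mul_le T i U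
  exact ⟨V, trivial, fun p hp ν => coeff_pderiv_mem T hV (hp _)⟩

section CotangentComplex

variable (I : Ideal (restricted T)) (hI : IsClosed (I : Set (restricted T)))

/-- The submodule `cl(I²)` of `I`, for a closed ideal `I` of `A⟨X⟩_T`. -/
noncomputable def closureSq : Submodule (restricted T) I := Submodule.comap I.subtype (I ^ 2).closure

/-- The completed conormal module: the separated completion of `I/I²`. Since `I` is closed in the
complete metrizable group `A⟨X⟩_T` (for `A` complete Huber), this completion is `I / cl(I²)`. -/
abbrev Conormal : Type u := I ⧸ closureSq T I

/-- The module `Ω¹ / I Ω¹`, where `Ω¹ = ⨁ᵢ A⟨X⟩_T dXᵢ` is the free module of topological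
differentials of `A⟨X⟩_T`. With `B = A⟨X⟩_T / I` it is `⨁ᵢ B dXᵢ`. -/
abbrev Differentials : Type u := Fin n → restricted T ⧸ I

/-- The map `I → ⨁ᵢ B dXᵢ`, `f ↦ df = ∑ᵢ (∂f/∂Xᵢ) dXᵢ`. -/
noncomputable def idealDifferential : I →ₗ[restricted T] Differentials T I where
  toFun f i := Ideal.Quotient.mk I (partialDeriv T i f.1)
  map_add' f g := by
    ext i
    simp [partialDeriv_add]
  map_smul' p f := by
    ext i
    have : Ideal.Quotient.mk I f.1 = 0 := Ideal.Quotient.eq_zero_iff_mem.2 f.2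
    simp only [Submodule.coe_smul, smul_eq_mul, partialDeriv_mul, map_add, map_mul, this,
      zero_mul, add_zero, RingHom.id_apply, Pi.smul_apply]
    rfl

lemma closureSq_le_ker (hI : IsClosed (I : Set (restricted T))) :
    closureSq T I ≤ LinearMap.ker (idealDifferential T I) := by
  intro f hf
  rw [LinearMap.mem_ker]
  ext i
  refine Ideal.Quotient.eq_zero_iff_mem.2 ?_
  have hf' : f.1 ∈ closure ((I ^ 2 : Ideal (restricted T)) : Set (restricted T)) := hf
  refine closure_minimal (t := partialDeriv T i ⁻¹' (I : Set (restricted T))) ?_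
    (hI.preimage (continuous_partialDeriv T i)) hf'
  intro g hg
  rw [pow_two] at hg
  change partialDeriv T i g ∈ I
  induction hg using Submodule.mul_induction_on' with
  | mem_mul_mem x hx y hy =>
    rw [partialDeriv_mul]
    exact I.add_mem (I.mul_mem_right _ hx) (I.mul_mem_right _ hy)
  | add x _ y _ hx hy => rw [partialDeriv_add]; exact I.add_mem hx hy

/-- The map `I / cl(I²) → ⨁ᵢ B dXᵢ` induced by `f ↦ df`. -/
noncomputable def conormalMap : Conormal T I →ₗ[restricted T] Differentials T I :=
  (closureSq T I).liftQ (idealDifferential T I) (closureSq_le_ker T I hI)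

/-- The truncated topological cotangent complex `[I / cl(I²) → Ω¹ / I Ω¹]` attached to the closed
ideal `I` of `A⟨X⟩_T`, with the differentials in degree `0` and the conormal module in homological
degree `1`. -/
noncomputable def cotangentComplex : ChainComplex (ModuleCat.{u} (restricted T)) ℕ :=
  HomologicalComplex.double (c := ComplexShape.down ℕ) (i₀ := 1) (i₁ := 0)
    (ModuleCat.ofHom (conormalMap T I hI)) rfl

end CotangentComplex

end RestrictedPowerSeries

/-- A pair `(A, A⁺)` of a nonarchimedean topological ring and a subring. The Huber pairs that are
considered are singled out by `IsCompleteAnalyticHuber`. -/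
structure RingPair : Type (u + 1) where
  carrier : Type u
  [commRing : CommRing carrier]
  [topologicalSpace : TopologicalSpace carrier]
  [nonarchimedeanRing : NonarchimedeanRing carrier]
  plus : Subring carrier

instance : CoeSort RingPair.{u} (Type u) := ⟨RingPair.carrier⟩

attribute [instance] RingPair.commRing RingPair.topologicalSpace RingPair.nonarchimedeanRing

section Boundedness

variable {A : Type u} [CommRing A] [TopologicalSpace A]

/-- Bounded subsets of a topological ring. -/
def IsBoundedSubset (S : Set A) : Prop :=
  ∀ U ∈ 𝓝 (0 : A), ∃ V ∈ 𝓝 (0 : A), ∀ v ∈ V, ∀ s ∈ S, v * s ∈ U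

/-- Power-bounded elements of a topological ring. -/
def IsPowerBounded (a : A) : Prop := IsBoundedSubset (Set.range fun k : ℕ => a ^ k)

end Boundedness

/-- `(A, A⁺)` is a complete (in particular Hausdorff) analytic Huber pair. -/
structure IsCompleteAnalyticHuber (A : RingPair.{u}) : Prop where
  t2 : T2Space A
  complete : @CompleteSpace A (IsTopologicalAddGroup.rightUniformSpace A)
  /-- There are an open subring `A₀` and a finitely generated ideal `J` of `A₀` such that the
  topology of `A₀` is the `J`-adic one. -/
  huber : ∃ A₀ : Subring A, IsOpen (A₀ : Set A) ∧ ∃ J : Ideal A₀, J.FG ∧ IsAdic J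
  /-- The topologically nilpotent elements generate the unit ideal. -/
  analytic : Ideal.span {a : A | IsTopologicallyNilpotent a} = ⊤
  plus_open : IsOpen (A.plus : Set A)
  plus_integrallyClosed : ∀ a : A, IsIntegral A.plus a → a ∈ A.plus
  plus_powerBounded : ∀ a ∈ A.plus, IsPowerBounded a

/-- `A` is uniform: the set of power-bounded elements is bounded. -/
def IsUniform (A : RingPair.{u}) : Prop := IsBoundedSubset {a : A | IsPowerBounded a}

/-- Morphisms of Huber pairs: continuous ring homomorphisms `A → B` mapping `A⁺` into `B⁺`. -/
structure IsMorphism {A B : RingPair.{u}} (f : A →+* B) : Prop where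
  continuous : Continuous f
  map_plus : ∀ a ∈ A.plus, f a ∈ B.plus

/-- `B⁺` is the integral closure in `B` of the image of the subring `R` of `A`. -/
def PlusIsIntegralClosure {R : Type u} [CommRing R] (R₀ : Subring R) {B : RingPair.{u}}
    (ψ : R →+* B) : Prop :=
  ∀ b : B, b ∈ B.plus ↔ IsIntegral (R₀.map ψ) b

/-- The pair `(A⟨X₁, …, Xₙ⟩, A⁺⟨X₁, …, Xₙ⟩)`. -/
noncomputable def tatePair (A : RingPair.{u}) (n : ℕ) : RingPair.{u} where
  carrier := restricted (Weights.one A n)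
  plus :=
    { carrier := {p | ∀ ν, MvPowerSeries.coeff ν p.1 ∈ A.plus}
      zero_mem' := fun ν => by simp
      one_mem' := fun ν => by
        classical
        change MvPowerSeries.coeff ν (1 : MvPowerSeries (Fin n) A) ∈ A.plus
        rw [MvPowerSeries.coeff_one]
        split_ifs
        exacts [A.plus.one_mem, A.plus.zero_mem]
      add_mem' := fun {p q} hp hq ν => by
        simpa using A.plus.add_mem (hp ν) (hq ν)
      neg_mem' := fun {p} hp ν => by
        simpa using hp ν
      mul_mem' := fun {p q} hp hq ν => by
        classical
        change MvPowerSeries.coeff ν (p.1 * q.1) ∈ A.plus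
        rw [MvPowerSeries.coeff_mul]
        exact A.plus.sum_mem fun x _ => A.plus.mul_mem (hp x.1) (hq x.2) }

/-- The inclusion `A → A⟨X₁, …, Xₙ⟩`. -/
noncomputable def tateConst (A : RingPair.{u}) (n : ℕ) : A →+* tatePair A n :=
  const (Weights.one A n)

/-- The variable `Xᵢ` of `A⟨X₁, …, Xₙ⟩`. -/
noncomputable def tateVar (A : RingPair.{u}) {n : ℕ} (i : Fin n) : tatePair A n :=
  var (Weights.one A n) i

/-- Elements `f₁, …, fₙ, g` generating the unit ideal (equivalently, in an analytic ring, an open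
ideal); they are the parameters of a rational subset. -/
structure RationalDatum (R : Type u) [CommRing R] where
  n : ℕ
  num : Fin n → R
  den : R
  span_eq_top : Ideal.span (insert den (Set.range num)) = ⊤

/-- The image of `(f₁, …, fₙ, g)` under a ring homomorphism. -/
def RationalDatum.map {R S : Type u} [CommRing R] [CommRing S] (D : RationalDatum R)
    (φ : R →+* S) : RationalDatum S where
  n := D.n
  num i := φ (D.num i)
  den := φ D.den
  span_eq_top := by
    have h := congrArg (Ideal.map φ) D.span_eq_top
    rw [Ideal.map_span, Ideal.map_top, Set.image_insert_eq, ← Set.range_comp] at h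
    exact h

/-- The points of `Spa(A, A⁺)`: the continuous valuations `v` of `A` with `v ≤ 1` on `A⁺`. (The
value group of `v` is generated by values of elements of `A`, so it suffices to test continuity
on the sets `{x | v x < v y}`.) -/
structure IsAdicPoint (A : RingPair.{u}) {Γ : Type u} [LinearOrderedCommGroupWithZero Γ]
    (v : Valuation A Γ) : Prop where
  continuous : ∀ y : A, IsOpen {x : A | v x < v y}
  le_one : ∀ a ∈ A.plus, v a ≤ 1

/-- The valuation `v` lies in the rational subset `{v(f₁), …, v(fₙ) ≤ v(g) ≠ 0}`. -/
def RationalDatum.Contains {R : Type u} [CommRing R] (D : RationalDatum R) {Γ : Type u}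
    [LinearOrderedCommGroupWithZero Γ] (v : Valuation R Γ) : Prop :=
  (∀ i, v (D.num i) ≤ v D.den) ∧ v D.den ≠ 0

/-- The rational subsets of `Spa(A, A⁺)` given by the family `D` cover `Spa(A, A⁺)`. -/
def Covers (A : RingPair.{u}) {m : ℕ} (D : Fin m → RationalDatum A) : Prop :=
  ∀ (Γ : Type u) [LinearOrderedCommGroupWithZero Γ] (v : Valuation A Γ),
    IsAdicPoint A v → ∃ j, (D j).Contains v

/-- `φ : (A, A⁺) → (B, B⁺)` is the rational localization
`A → A⟨f₁/g, …, fₙ/g⟩ = A⟨X₁, …, Xₙ⟩ / cl(g X₁ - f₁, …, g Xₙ - fₙ)`, where `B` carries the quotient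
topology and `B⁺` is the integral closure of the image of `A⁺⟨X₁, …, Xₙ⟩`. -/
def IsRationalLocalizationAt {A B : RingPair.{u}} (D : RationalDatum A) (φ : A →+* B) : Prop :=
  ∃ ψ : tatePair A D.n →+* B,
    ψ.comp (tateConst A D.n) = φ ∧ Continuous ψ ∧ IsOpenMap ψ ∧ Function.Surjective ψ ∧
    RingHom.ker ψ = (Ideal.span (Set.range fun i =>
      tateConst A D.n D.den * tateVar A i - tateConst A D.n (D.num i))).closure ∧
    PlusIsIntegralClosure (tatePair A D.n).plus ψ

/-- `φ` is a rational localization. -/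
def IsRationalLocalization {A B : RingPair.{u}} (φ : A →+* B) : Prop :=
  ∃ D : RationalDatum A, IsRationalLocalizationAt D φ

/-- `φ : (A, A⁺) → (B, B⁺)` is finite étale: `B` is a finite étale `A`-algebra with its natural
topology as a finitely generated `A`-module, and `B⁺` is the integral closure of `A⁺`. -/
structure IsFiniteEtale {A B : RingPair.{u}} (φ : A →+* B) : Prop where
  finite : φ.Finite
  etale : φ.Etale
  topology : letI := φ.toAlgebra.toModule; IsModuleTopology A B
  plus : PlusIsIntegralClosure A.plus φ

/-- Finite composites of rational localizations and finite étale morphisms. -/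
inductive IsComposite : ∀ {A B : RingPair.{u}}, (A →+* B) → Prop
  | rational {A B : RingPair.{u}} {φ : A →+* B} (h : IsRationalLocalization φ) : IsComposite φ
  | finiteEtale {A B : RingPair.{u}} {φ : A →+* B} (h : IsFiniteEtale φ) : IsComposite φ
  | comp {A B C : RingPair.{u}} {φ : A →+* B} {ψ : B →+* C} (hφ : IsComposite φ)
      (hψ : IsComposite ψ) : IsComposite (ψ.comp φ)

/-- A finite covering of `Spa(A, A⁺)` by rational subsets, with the rings of sections
`(A, A⁺) → (Aⱼ, Aⱼ⁺)` of its members. -/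
structure RationalCovering (A : RingPair.{u}) where
  m : ℕ
  datum : Fin m → RationalDatum A
  covers : Covers A datum
  obj : Fin m → RingPair.{u}
  map : ∀ j, A →+* obj j
  isLocalization : ∀ j, IsRationalLocalizationAt (datum j) (map j)

/-- `(A, A⁺)` is sheafy: the structure presheaf on `Spa(A, A⁺)` is a sheaf of topological rings.
That is, for every rational subset of `Spa(A, A⁺)`, with ring of sections `S`, and every finite
covering of it by rational subsets, with rings of sections `Sⱼ`, and `Sᵢⱼ` the rings of sections of
the pairwise intersections, `S` is, as a topological ring, the equalizer of
`∏ Sⱼ ⇉ ∏ Sᵢⱼ`. -/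
def IsSheafy (A : RingPair.{u}) : Prop :=
  ∀ (S : RingPair.{u}) (φ : A →+* S), IsRationalLocalization φ →
  ∀ (𝒰 : RationalCovering S) (O : Fin 𝒰.m → Fin 𝒰.m → RingPair.{u})
    (l : ∀ i j, 𝒰.obj i →+* O i j) (r : ∀ i j, 𝒰.obj j →+* O i j),
    (∀ i j, IsRationalLocalizationAt ((𝒰.datum j).map (𝒰.map i)) (l i j)) →
    (∀ i j, IsRationalLocalizationAt ((𝒰.datum i).map (𝒰.map j)) (r i j)) →
    (∀ i j, (l i j).comp (𝒰.map i) = (r i j).comp (𝒰.map j)) →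
    Topology.IsEmbedding (fun (s : S) (j : Fin 𝒰.m) => 𝒰.map j s) ∧
    Set.range (fun (s : S) (j : Fin 𝒰.m) => 𝒰.map j s) =
      {x : ∀ j, 𝒰.obj j | ∀ i j, l i j (x i) = r i j (x j)}

/-- `(A, A⁺)` is strongly sheafy: `A⟨X₁, …, Xₙ⟩` is sheafy for every `n ≥ 0`. -/
def IsStronglySheafy (A : RingPair.{u}) : Prop := ∀ n, IsSheafy (tatePair A n)

/-- `f : (A, A⁺) → (B, B⁺)` is naive étale: `(A, A⁺)` and `(B, B⁺)` are strongly sheafy, and, locally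
for the rational topology, `f` is a composite of rational localizations and finite étale
morphisms. -/
structure IsNaiveEtale {A B : RingPair.{u}} (f : A →+* B) : Prop where
  morphism : IsMorphism f
  source : IsStronglySheafy A
  target : IsStronglySheafy B
  locally_composite : ∃ 𝒰 : RationalCovering B, ∀ j, IsComposite ((𝒰.map j).comp f)

/-- A presentation `B = A⟨X₁, …, Xₙ⟩_{T₁, …, Tₙ} / I` of `f : A → B` as a morphism of topologically
finite type: a continuous open surjection with closed kernel `I` extending `f`. -/
structure Presentation {A B : RingPair.{u}} (f : A →+* B) where
  n : ℕ
  weights : Weights A n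
  map : restricted weights →+* B
  map_const : map.comp (const weights) = f
  continuous : Continuous map
  isOpenMap : IsOpenMap map
  surjective : Function.Surjective map
  isClosed_ker : IsClosed (RingHom.ker map : Set (restricted weights))

/-- The truncated topological cotangent complex `τ_{≤1} L_{B/A,topo}` of `f : A → B`, computed by a
presentation of `B` over `A`. -/
noncomputable def Presentation.cotangentComplex {A B : RingPair.{u}} {f : A →+* B}
    (P : Presentation f) : ChainComplex (ModuleCat.{u} (restricted P.weights)) ℕ :=
  NaiveEtale.cotangentComplex P.weights (RingHom.ker P.map) P.isClosed_ker

open scoped ZeroObject in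
/-- `B` is of topologically finite type over `A` and `τ_{≤1} L_{B/A,topo}` is quasi-isomorphic to
zero (whichever presentation of `B` over `A` is used to compute it). -/
def CotangentComplexVanishes {A B : RingPair.{u}} (f : A →+* B) : Prop :=
  Nonempty (Presentation f) ∧
    ∀ P : Presentation f, QuasiIso (0 : P.cotangentComplex ⟶ (0 : ChainComplex _ ℕ))

end NaiveEtale

/-!
The members `C` of a covering of `Spa(B, B⁺)` on which `A → B` becomes a finite composite of
rational localizations and finite étale morphisms already satisfy the claim. Two properties of
`A → C` are proved by induction on the composite.

* Continuous derivations of `C` over `A` vanish (`IsComposite.hasNoDerivations`). For a rational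
  localization, the relations `g xᵢ = fᵢ` with `g` a unit force `d xᵢ = 0`, and the `xᵢ` generate
  topologically.
* A continuous map to `C` lifts along complete topological square-zero extensions `E → C`
  (`IsComposite.hasLifts`). For a finite étale morphism the algebraic lift is continuous, as the
  target has the module topology. For a rational localization one sends `xᵢ` to `fᵢ / g`, computed
  in `E`. This makes sense because power-boundedness lifts along square-zero extensions
  (`isPowerBounded_of_lifts`); analyticity is needed to lift bounded sets to bounded sets.

Let `C = P / I` be a presentation. Lifting the identity of `C` to `P / cl(I²)` gives a section,
whose difference with the projection is a derivation `P → I / cl(I²)` that is the identity on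
`I`. By the chain rule for continuous derivations it yields a left inverse of
`I / cl(I²) → ⨁ C dXᵢ`, and the vanishing of derivations shows that this is also a right inverse
(`conormalMap_bijective`).

A presentation exists because being topologically of finite type is stable under composition.
This is expressed by a condition that makes no reference to completeness (`IsTopGen`); only at
the end, where `C` is known to be complete, does the open mapping principle turn it into a
quotient map from a ring of restricted power series (`IsTopGen.exists_isOpenQuotientMap`). For
finite morphisms over an analytic ring, the weights are small elements generating the unit ideal
(`isTopFiniteType_of_finite`).
-/

namespace NaiveEtale

/-! ### Complete nonarchimedean groups -/

section Groups

open Filter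

variable {G H : Type*} [AddCommGroup G] [TopologicalSpace G] [AddCommGroup H] [TopologicalSpace H]

/-- Completeness of a commutative topological group for its group uniformity, as a property of the
topology alone, so that no uniform structure has to be carried along. -/
def IsCompleteGroup (G : Type*) [AddCommGroup G] [TopologicalSpace G]
    [IsTopologicalAddGroup G] : Prop :=
  @CompleteSpace G (IsTopologicalAddGroup.rightUniformSpace G)

lemma IsCompleteGroup.summable [NonarchimedeanAddGroup G] (hG : IsCompleteGroup G) {ι : Type*}
    {f : ι → G} (hf : Tendsto f cofinite (𝓝 0)) : Summable f := by
  let := IsTopologicalAddGroup.rightUniformSpace G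
  have : IsUniformAddGroup G := isUniformAddGroup_of_addCommGroup
  have : CompleteSpace G := hG
  exact NonarchimedeanAddGroup.summable_of_tendsto_cofinite_zero hf

lemma cauchySeq_iff_sub_mem [IsTopologicalAddGroup G] (x : ℕ → G) :
    @CauchySeq G ℕ (IsTopologicalAddGroup.rightUniformSpace G) _ x ↔
      ∀ U ∈ 𝓝 (0 : G), ∃ N, ∀ m ≥ N, ∀ n ≥ N, x m - x n ∈ U := by
  let := IsTopologicalAddGroup.rightUniformSpace G
  have : IsUniformAddGroup G := isUniformAddGroup_of_addCommGroup
  have hb : (uniformity G).HasBasis (fun U => U ∈ 𝓝 (0 : G))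
      fun U => {p : G × G | p.2 - p.1 ∈ U} := by
    rw [uniformity_eq_comap_nhds_zero G]
    exact (𝓝 (0 : G)).basis_sets.comap _
  rw [hb.cauchySeq_iff]
  exact forall₂_congr fun U _ => exists_congr fun N =>
    ⟨fun h m hm n hn => h n hn m hm, fun h m hm n hn => h n hn m hm⟩

lemma IsCompleteGroup.exists_tendsto [IsTopologicalAddGroup G] (hG : IsCompleteGroup G) {x : ℕ → G}
    (hx : ∀ U ∈ 𝓝 (0 : G), ∃ N, ∀ m ≥ N, ∀ n ≥ N, x m - x n ∈ U) :
    ∃ a, Tendsto x atTop (𝓝 a) := by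
  let := IsTopologicalAddGroup.rightUniformSpace G
  have : CompleteSpace G := hG
  exact cauchySeq_tendsto_of_complete ((cauchySeq_iff_sub_mem x).2 hx)

lemma isCompleteGroup_of_exists_tendsto [IsTopologicalAddGroup G] [FirstCountableTopology G]
    (h : ∀ x : ℕ → G, (∀ U ∈ 𝓝 (0 : G), ∃ N, ∀ m ≥ N, ∀ n ≥ N, x m - x n ∈ U) →
      ∃ a, Tendsto x atTop (𝓝 a)) : IsCompleteGroup G := by
  let := IsTopologicalAddGroup.rightUniformSpace G
  have : IsUniformAddGroup G := isUniformAddGroup_of_addCommGroup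
  have : (uniformity G).IsCountablyGenerated := by
    rw [uniformity_eq_comap_nhds_zero G]
    infer_instance
  exact UniformSpace.complete_of_cauchySeq_tendsto fun x hx =>
    h x ((cauchySeq_iff_sub_mem x).1 hx)

lemma IsCompleteGroup.of_isOpenQuotientMap [IsTopologicalAddGroup G] [IsTopologicalAddGroup H]
    [FirstCountableTopology G] (hG : IsCompleteGroup G) (φ : G →+ H) (hφ : IsOpenQuotientMap φ) :
    IsCompleteGroup H := by
  have : @CompleteSpace G (IsTopologicalAddGroup.rightUniformSpace G) := hG
  have hQ := QuotientAddGroup.completeSpace_right' G φ.ker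
  let e : G ⧸ φ.ker ≃+ H := QuotientAddGroup.quotientKerEquivOfSurjective φ hφ.surjective
  have hcomp : (e ∘ QuotientAddGroup.mk : G → H) = φ := rfl
  have he : IsHomeomorph e := by
    refine ⟨?_, ?_, e.bijective⟩
    · rw [← QuotientAddGroup.isOpenQuotientMap_mk.continuous_comp_iff, hcomp]
      exact hφ.continuous
    · intro U hU
      have : e '' U = φ '' (QuotientAddGroup.mk ⁻¹' U) := by
        rw [← hcomp, Set.image_comp, Set.image_preimage_eq _ QuotientAddGroup.mk_surjective]
      rw [this]
      exact hφ.isOpenMap _ (hU.preimage continuous_quot_mk)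
  let := IsTopologicalAddGroup.rightUniformSpace (G ⧸ φ.ker)
  let := IsTopologicalAddGroup.rightUniformSpace H
  have : IsUniformAddGroup (G ⧸ φ.ker) := isUniformAddGroup_of_addCommGroup
  have : IsUniformAddGroup H := isUniformAddGroup_of_addCommGroup
  exact ((AddMonoidHom.isUniformInducing_of_isInducing (f := e)
    he.isInducing).completeSpace_congr e.surjective).1 hQ

lemma exists_antitone_openAddSubgroup (G : Type*) [AddCommGroup G] [TopologicalSpace G]
    [NonarchimedeanAddGroup G] [FirstCountableTopology G] :
    ∃ V : ℕ → OpenAddSubgroup G, Antitone V ∧ ∀ S ∈ 𝓝 (0 : G), ∃ n, (V n : Set G) ⊆ S := by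
  obtain ⟨u, hu⟩ := (𝓝 (0 : G)).exists_antitone_basis
  choose W hW using fun n =>
    NonarchimedeanAddGroup.is_nonarchimedean (u n) (hu.1.mem_of_mem trivial)
  refine ⟨fun n => (Finset.range (n + 1)).inf W, fun m n hmn =>
    Finset.inf_mono (Finset.range_mono (by lia)), fun S hS => ?_⟩
  obtain ⟨n, -, hn⟩ := hu.1.mem_iff.1 hS
  have h : (Finset.range (n + 1)).inf W ≤ W n := Finset.inf_le (by simp)
  exact ⟨n, fun x hx => hn (hW n (h hx))⟩

/-- The open mapping principle: successive approximation turns density of the images of open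
subgroups into openness. -/
theorem isOpenMap_of_closure_image_mem_nhds [NonarchimedeanAddGroup G] [FirstCountableTopology G]
    (hG : IsCompleteGroup G) [NonarchimedeanAddGroup H] [T2Space H] (φ : G →+ H)
    (hφ : Continuous φ)
    (h : ∀ U : OpenAddSubgroup G, closure (φ '' (U : Set G)) ∈ 𝓝 (0 : H)) : IsOpenMap φ := by
  have key : ∀ S ∈ 𝓝 (0 : G), φ '' S ∈ 𝓝 (0 : H) := by
    intro S hS
    obtain ⟨V, hV, hbasis⟩ := exists_antitone_openAddSubgroup G
    obtain ⟨k, hk⟩ := hbasis S hS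
    refine mem_of_superset (h (V k)) ?_
    refine fun y hy => Set.image_mono hk ?_
    -- One step of the approximation: the error moves into the closure of the next image.
    have step : ∀ n, ∀ z ∈ closure (φ '' (V (k + n) : Set G)),
        ∃ p ∈ V (k + n), z - φ p ∈ closure (φ '' (V (k + (n + 1)) : Set G)) := by
      intro n z hz
      have hn : {w | z - w ∈ closure (φ '' (V (k + (n + 1)) : Set G))} ∈ 𝓝 z := by
        have : Tendsto (fun w => z - w) (𝓝 z) (𝓝 0) := by
          simpa using (continuous_const.sub continuous_id).tendsto (f := fun w => z - w) z
        exact this (h _)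
      obtain ⟨_, hw, p, hp, rfl⟩ := mem_closure_iff_nhds.1 hz _ hn
      exact ⟨p, hp, hw⟩
    choose! p hp hp' using step
    let r : ℕ → H := fun n => Nat.rec y (fun n z => z - φ (p n z)) n
    have hr : ∀ n, r n ∈ closure (φ '' (V (k + n) : Set G)) := by
      intro n
      induction n with
      | zero => exact hy
      | succ n ih => exact hp' n _ ih
    let q : ℕ → G := fun n => p n (r n)
    have hq : ∀ n, q n ∈ V (k + n) := fun n => hp n _ (hr n)
    have hq0 : Tendsto q cofinite (𝓝 0) := by
      rw [Nat.cofinite_eq_atTop]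
      intro S' hS'
      obtain ⟨m, hm⟩ := hbasis S' hS'
      exact mem_atTop_sets.2 ⟨m, fun n hn => hm (hV (by lia : m ≤ k + n) (hq n))⟩
    obtain ⟨a, ha⟩ := hG.summable hq0
    have hsum := ha.tendsto_sum_nat
    refine ⟨a, ?_, ?_⟩
    · refine (V k).isClosed.mem_of_tendsto hsum (Eventually.of_forall fun n => ?_)
      exact (V k).toAddSubgroup.sum_mem fun i _ => hV (by lia : k ≤ k + i) (hq i)
    · have hr' : ∀ n, φ (∑ i ∈ Finset.range n, q i) = y - r n := by
        intro n
        induction n with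
        | zero => simp [r]
        | succ n ih =>
          rw [Finset.sum_range_succ, map_add, ih]
          change y - r n + φ (p n (r n)) = y - (r n - φ (p n (r n)))
          abel
      have hr0 : Tendsto r atTop (𝓝 0) := by
        intro W hW
        obtain ⟨W', hW'⟩ := NonarchimedeanAddGroup.is_nonarchimedean W hW
        have : φ ⁻¹' (W' : Set H) ∈ 𝓝 (0 : G) :=
          hφ.continuousAt.preimage_mem_nhds (by rw [map_zero]; exact W'.mem_nhds_zero)
        obtain ⟨m, hm⟩ := hbasis _ this
        refine mem_atTop_sets.2 ⟨m, fun n hn => hW' ?_⟩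
        refine closure_minimal ?_ W'.isClosed (hr n)
        rintro _ ⟨x, hx, rfl⟩
        exact hm (hV (by lia : m ≤ k + n) hx)
      have h1 := (hφ.tendsto a).comp hsum
      have h2 : Tendsto (fun n => y - r n) atTop (𝓝 (y - 0)) := tendsto_const_nhds.sub hr0
      rw [sub_zero] at h2
      refine tendsto_nhds_unique h1 ?_
      simpa only [Function.comp_def, hr'] using h2
  refine isOpenMap_iff_nhds_le.2 fun x S hS => ?_
  have h1 : (fun g => x + g) ⁻¹' (φ ⁻¹' S) ∈ 𝓝 (0 : G) := by
    refine (continuous_const.add continuous_id).continuousAt.preimage_mem_nhds ?_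
    simpa using hS
  have h2 := key _ h1
  have h3 : (fun y => φ x + y) '' (φ '' ((fun g => x + g) ⁻¹' (φ ⁻¹' S))) ∈ 𝓝 (φ x) := by
    have := (isOpenMap_add_left (φ x)).image_mem_nhds h2
    simpa using this
  refine mem_of_superset h3 ?_
  rintro _ ⟨_, ⟨g, hg, rfl⟩, rfl⟩
  simpa using hg

end Groups

/-! ### The topology of rings of restricted power series -/

section Restricted

open Filter

variable {A : Type u} [CommRing A] [TopologicalSpace A] [NonarchimedeanRing A] {n : ℕ}
  (T : Weights A n)

/-- The monomial `a X^ν`, as an element of `A⟨X⟩_T`. -/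
noncomputable def mono (ν : Fin n →₀ ℕ) (a : A) : restricted T :=
  ⟨MvPowerSeries.monomial ν a, fun U => by
    classical
    refine (Set.finite_singleton ν).subset fun μ hμ => ?_
    by_contra h
    apply hμ
    change MvPowerSeries.coeff μ (MvPowerSeries.monomial ν a) ∈ T.pow μ * U.1
    rw [MvPowerSeries.coeff_monomial, if_neg (by simpa using h)]
    exact Submodule.zero_mem _⟩

variable {T}

lemma coeff_mono [DecidableEq (Fin n →₀ ℕ)] (μ ν : Fin n →₀ ℕ) (a : A) :
    MvPowerSeries.coeff μ (mono T ν a).1 = if μ = ν then a else 0 := by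
  classical
  refine (MvPowerSeries.coeff_monomial _ _ _).trans ?_
  congr

lemma mono_mul_mono (μ ν : Fin n →₀ ℕ) (a b : A) :
    mono T μ a * mono T ν b = mono T (μ + ν) (a * b) :=
  Subtype.ext (MvPowerSeries.monomial_mul_monomial _ _ _ _)

lemma mono_zero_eq_const (a : A) : mono T 0 a = const T a := rfl

lemma mono_single_eq_var (i : Fin n) : mono T (Finsupp.single i 1) 1 = var T i := rfl

lemma mono_eq_const_mul_prod (ν : Fin n →₀ ℕ) (a : A) :
    mono T ν a = const T a * ∏ i, var T i ^ ν i := by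
  refine Subtype.ext ?_
  have h : ((const T a * ∏ i, var T i ^ ν i : restricted T) : MvPowerSeries (Fin n) A) =
      MvPowerSeries.C a * ∏ i, MvPowerSeries.X i ^ ν i := by
    rw [Subring.coe_mul, SubmonoidClass.coe_finsetProd]
    rfl
  rw [h, ← MvPowerSeries.monomial_zero_eq_C_apply]
  change MvPowerSeries.monomial ν a = _
  have h2 : ∏ i, (MvPowerSeries.X i : MvPowerSeries (Fin n) A) ^ ν i =
      MvPowerSeries.monomial ν 1 := by
    rw [MvPowerSeries.monomial_one_eq, Finsupp.prod_fintype _ _ (by simp)]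
  rw [h2, MvPowerSeries.monomial_mul_monomial, zero_add, mul_one]

lemma mono_mem_restrictedNhd {U : OpenSubmod A} {ν : Fin n →₀ ℕ} {a : A} (ha : a ∈ T.pow ν * U.1) :
    mono T ν a ∈ restrictedNhd T U := by
  classical
  intro μ
  rw [coeff_mono]
  split_ifs with h
  · rwa [h]
  · exact Submodule.zero_mem _

lemma isOpen_restrictedNhd (U : OpenSubmod A) : IsOpen (restrictedNhd T U : Set (restricted T)) :=
  AddSubgroup.isOpen_of_mem_nhds _ (g := 0) ((restricted_hasBasis T).mem_of_mem trivial)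

lemma exists_sub_sum_mono_mem (p : restricted T) (V : OpenSubmod A) :
    ∃ F : Finset (Fin n →₀ ℕ),
      p - ∑ μ ∈ F, mono T μ (MvPowerSeries.coeff μ p.1) ∈ restrictedNhd T V := by
  classical
  have hF : {μ | MvPowerSeries.coeff μ p.1 ∉ T.pow μ * V.1}.Finite := p.2 V
  refine ⟨hF.toFinset, fun ν => ?_⟩
  rw [AddSubgroupClass.coe_sub, map_sub, AddSubmonoidClass.coe_finsetSum, map_sum]
  simp only [coeff_mono, Finset.sum_ite_eq, Set.Finite.mem_toFinset]
  split_ifs with h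
  · simp
  · simpa using h

/-- The elements of `U⟨X⟩_T` are limits of polynomials in `U⟨X⟩_T`. -/
lemma mem_of_mem_restrictedNhd {S : AddSubgroup (restricted T)}
    (hS : IsClosed (S : Set (restricted T))) {U : OpenSubmod A}
    (h : ∀ ν, ∀ a ∈ T.pow ν * U.1, mono T ν a ∈ S) {p : restricted T}
    (hp : p ∈ restrictedNhd T U) : p ∈ S := by
  rw [← SetLike.mem_coe, ← hS.closure_eq, mem_closure_iff_nhds]
  intro N hN
  have h0 : Tendsto (fun x => p - x) (𝓝 0) (𝓝 p) := by
    simpa using (continuous_const.sub continuous_id).tendsto (f := fun x => p - x) 0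
  obtain ⟨V, -, hV⟩ := (restricted_hasBasis T).mem_iff.1 (h0 hN)
  obtain ⟨F, hF⟩ := exists_sub_sum_mono_mem p V
  refine ⟨_, ?_, S.sum_mem (t := F) fun μ _ => h μ _ (hp μ)⟩
  simpa using hV hF

lemma mem_of_mono_mem {S : AddSubgroup (restricted T)} (hS : IsClosed (S : Set (restricted T)))
    (h : ∀ ν a, mono T ν a ∈ S) (p : restricted T) : p ∈ S := by
  obtain ⟨F, hF⟩ := exists_sub_sum_mono_mem p (⟨⊤, by simp⟩ : OpenSubmod A)
  simpa using S.add_mem (mem_of_mem_restrictedNhd hS (fun ν a _ => h ν a) hF)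
    (S.sum_mem (t := F) fun μ _ => h μ (MvPowerSeries.coeff μ p.1))

/-- Continuous additive maps on `A⟨X⟩_T` are determined by their values on monomials. -/
lemma eq_of_eq_on_mono {H : Type*} [AddCommGroup H] [TopologicalSpace H] [T2Space H]
    {φ ψ : restricted T →+ H} (hφ : Continuous φ) (hψ : Continuous ψ)
    (h : ∀ ν a, φ (mono T ν a) = ψ (mono T ν a)) : φ = ψ :=
  AddMonoidHom.ext <| mem_of_mono_mem (S := φ.eqLocus ψ) (isClosed_eq hφ hψ) h

/-- Constants and variables topologically generate `A⟨X⟩_T`. -/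
lemma mem_of_const_mem_of_var_mem {S : Subring (restricted T)}
    (hS : IsClosed (S : Set (restricted T))) (hc : ∀ a, const T a ∈ S) (hv : ∀ i, var T i ∈ S)
    (p : restricted T) : p ∈ S :=
  mem_of_mono_mem (S := S.toAddSubgroup) hS (fun ν a => by
    rw [mono_eq_const_mul_prod]
    exact S.mul_mem (hc a) (S.prod_mem fun i _ => S.pow_mem (hv i) _)) p

lemma exists_pow_mul_le (T : Weights A n) (ν : Fin n →₀ ℕ) (U : OpenSubmod A) :
    ∃ V : OpenSubmod A, T.pow ν * V.1 ≤ U.1 := by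
  let Q : Submodule ℤ A → Prop := fun M => ∀ U : OpenSubmod A, ∃ V : OpenSubmod A, M * V.1 ≤ U.1
  have hone : Q 1 := fun U => ⟨U, by rw [one_mul]⟩
  have hmul : ∀ M N, Q M → Q N → Q (M * N) := fun M N hM hN U => by
    obtain ⟨V, hV⟩ := hM U
    obtain ⟨W, hW⟩ := hN V
    exact ⟨W, by rw [mul_assoc]; exact (mul_le_mul' le_rfl hW).trans hV⟩
  have hpow : ∀ M k, Q M → Q (M ^ k) := fun M k hM => by
    induction k with
    | zero => rwa [pow_zero]
    | succ k ih => rw [pow_succ]; exact hmul _ _ ih hM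
  exact Finset.prod_induction _ Q hmul hone (fun i _ => hpow _ _ (exists_span_mul_le T i)) U

lemma continuous_coeff (ν : Fin n →₀ ℕ) :
    Continuous fun p : restricted T => MvPowerSeries.coeff ν p.1 := by
  let f : restricted T →+ A := AddMonoidHom.mk' (fun p => MvPowerSeries.coeff ν p.1)
    (fun p q => by simp)
  refine continuous_of_continuousAt_zero f ?_
  unfold ContinuousAt
  rw [map_zero]
  intro S hS
  obtain ⟨U, hU⟩ := exists_openSubmod hS
  obtain ⟨V, hV⟩ := exists_pow_mul_le T ν U
  have h0 := (isOpen_restrictedNhd (T := T) V).mem_nhds (zero_mem _)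
  exact mem_map.2 (mem_of_superset h0 fun p hp => hU (hV (hp ν)))

lemma continuous_constHom : Continuous (const T) := by
  refine continuous_of_continuousAt_zero (const T) ?_
  unfold ContinuousAt
  rw [map_zero]
  refine ((restricted_hasBasis T).tendsto_right_iff).2 fun U _ => ?_
  filter_upwards [U.mem_nhds] with a ha
  rw [← mono_zero_eq_const]
  exact mono_mem_restrictedNhd (by rwa [Weights.pow_zero, one_mul])

instance [T2Space A] : T2Space (restricted T) := by
  refine T2Space.of_injective_continuous (f := fun p : restricted T => (fun ν =>
    MvPowerSeries.coeff ν p.1 : (Fin n →₀ ℕ) → A)) (fun p q h => ?_)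
    (continuous_pi continuous_coeff)
  exact Subtype.ext (MvPowerSeries.ext fun ν => congrFun h ν)

instance [FirstCountableTopology A] : FirstCountableTopology (restricted T) := by
  obtain ⟨V, -, hV⟩ := exists_antitone_openAddSubgroup A
  let V' : ℕ → OpenSubmod A := fun k =>
    ⟨AddSubgroup.toIntSubmodule (V k).toAddSubgroup, (V k).isOpen⟩
  have hb : (𝓝 (0 : restricted T)).HasBasis (fun _ : ℕ => True)
      fun k => (restrictedNhd T (V' k) : Set (restricted T)) := by
    refine (restricted_hasBasis T).to_hasBasis (fun U _ => ?_) fun k _ => ⟨V' k, trivial, le_rfl⟩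
    obtain ⟨k, hk⟩ := hV _ U.mem_nhds
    exact ⟨k, trivial, fun p hp ν =>
      mul_le_mul' (le_refl (T.pow ν)) (show (V' k).1 ≤ U.1 from hk) (hp ν)⟩
  have h0 : (𝓝 (0 : restricted T)).IsCountablyGenerated := hb.isCountablyGenerated
  refine ⟨fun p => ?_⟩
  rw [← map_add_left_nhds_zero p]
  infer_instance

lemma isCompleteGroup_restricted [T2Space A] [FirstCountableTopology A] (hA : IsCompleteGroup A) :
    IsCompleteGroup (restricted T) := by
  refine isCompleteGroup_of_exists_tendsto fun x hx => ?_
  have hcoeff : ∀ ν, ∃ a, Tendsto (fun k => MvPowerSeries.coeff ν (x k).1) atTop (𝓝 a) := by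
    intro ν
    refine hA.exists_tendsto fun U hU => ?_
    obtain ⟨N, hN⟩ := hx _ (((continuous_coeff (T := T) ν).tendsto 0) (by simpa using hU))
    exact ⟨N, fun m hm k hk => by simpa using hN m hm k hk⟩
  choose a ha using hcoeff
  have hclose : ∀ U : OpenSubmod A, ∃ N, ∀ m ≥ N, ∀ ν,
      MvPowerSeries.coeff ν (x m).1 - a ν ∈ T.pow ν * U.1 := by
    intro U
    obtain ⟨N, hN⟩ := hx _ ((isOpen_restrictedNhd (T := T) U).mem_nhds (zero_mem _))
    refine ⟨N, fun m hm ν => ?_⟩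
    have hcl : IsClosed ((T.pow ν * U.1 : Submodule ℤ A) : Set A) :=
      AddSubgroup.isClosed_of_isOpen (T.pow ν * U.1).toAddSubgroup (T.preservesOpen ν U)
    refine hcl.mem_of_tendsto (tendsto_const_nhds.sub (ha ν)) ?_
    filter_upwards [eventually_ge_atTop N] with k hk
    simpa using hN m hm k hk ν
  have hrestr : IsRestricted T (fun ν => a ν : MvPowerSeries (Fin n) A) := by
    intro U
    obtain ⟨N, hN⟩ := hclose U
    filter_upwards [(x N).2 U] with ν hν
    have := Submodule.sub_mem _ hν (hN N le_rfl ν)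
    rwa [sub_sub_cancel] at this
  refine ⟨⟨_, hrestr⟩, ?_⟩
  rw [tendsto_iff_forall_eventually_mem]
  intro S hS
  have h0 : (fun y => ⟨_, hrestr⟩ + y) ⁻¹' S ∈ 𝓝 (0 : restricted T) :=
    (continuous_const.add continuous_id).continuousAt.preimage_mem_nhds (by simpa using hS)
  obtain ⟨U, -, hU⟩ := (restricted_hasBasis T).mem_iff.1 h0
  obtain ⟨N, hN⟩ := hclose U
  filter_upwards [eventually_ge_atTop N] with m hm
  have : x m - ⟨_, hrestr⟩ ∈ restrictedNhd T U := fun ν => hN m hm ν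
  simpa using hU this

/-! ### Evaluation of restricted power series -/

section Evaluation

variable {C : Type*} [CommRing C] [TopologicalSpace C] [NonarchimedeanRing C]

/-- The terms of the series `∑ f(a_ν) c^ν` tend to `0` uniformly as the coefficients of
`∑ a_ν X^ν` tend to `0` in `A⟨X⟩_T`: this is what evaluation at `c` needs. -/
def CanEvaluate (T : Weights A n) (f : A →+* C) (c : Fin n → C) : Prop :=
  ∀ W ∈ 𝓝 (0 : C), ∃ U : OpenSubmod A, ∀ ν, ∀ a ∈ T.pow ν * U.1, f a * ∏ i, c i ^ ν i ∈ W

variable {f : A →+* C} {c : Fin n → C}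

lemma CanEvaluate.summable (h : CanEvaluate T f c) (hC : IsCompleteGroup C) (p : restricted T) :
    Summable fun ν => f (MvPowerSeries.coeff ν p.1) * ∏ i, c i ^ ν i := by
  refine hC.summable (tendsto_iff_forall_eventually_mem.2 fun W hW => ?_)
  obtain ⟨U, hU⟩ := h W hW
  filter_upwards [p.2 U] with ν hν using hU ν _ hν

/-- Evaluation of restricted power series. -/
theorem CanEvaluate.exists_ringHom [T2Space C] (h : CanEvaluate T f c) (hC : IsCompleteGroup C) :
    ∃ φ : restricted T →+* C, Continuous φ ∧ φ.comp (const T) = f ∧ ∀ i, φ (var T i) = c i := by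
  classical
  let e : restricted T →+ C := AddMonoidHom.mk'
    (fun p => ∑' ν, f (MvPowerSeries.coeff ν p.1) * ∏ i, c i ^ ν i) fun p q => by
      rw [← (h.summable hC p).tsum_add (h.summable hC q)]
      exact tsum_congr fun ν => by rw [Subring.coe_add, map_add, map_add, add_mul]
  have he : Continuous e := by
    refine continuous_of_continuousAt_zero e ?_
    unfold ContinuousAt
    rw [map_zero]
    intro S hS
    obtain ⟨W, hW⟩ := exists_openSubmod hS
    obtain ⟨U, hU⟩ := h _ W.mem_nhds
    have h0 := (isOpen_restrictedNhd (T := T) U).mem_nhds (zero_mem _)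
    refine mem_map.2 (mem_of_superset h0 fun p hp => hW ?_)
    exact (AddSubgroup.isClosed_of_isOpen W.1.toAddSubgroup W.2).mem_of_tendsto
      (h.summable hC p).hasSum
      (Eventually.of_forall fun s => W.1.sum_mem fun ν _ => hU ν _ (hp ν))
  have hmono : ∀ ν a, e (mono T ν a) = f a * ∏ i, c i ^ ν i := by
    intro ν a
    refine (tsum_eq_single ν fun μ hμ => ?_).trans ?_
    · rw [coeff_mono, if_neg hμ, map_zero, zero_mul]
    · rw [coeff_mono, if_pos rfl]
  -- Multiplicativity holds on monomials, hence everywhere by continuity in each factor.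
  have hmul1 : ∀ ν a, ∀ q, e (mono T ν a * q) = e (mono T ν a) * e q := by
    intro ν a q
    refine DFunLike.congr_fun (eq_of_eq_on_mono
      (φ := e.comp (AddMonoidHom.mulLeft (mono T ν a)))
      (ψ := (AddMonoidHom.mulLeft (e (mono T ν a))).comp e)
      (he.comp (continuous_const_mul _)) ((continuous_const_mul _).comp he) fun μ b => ?_) q
    simp only [AddMonoidHom.comp_apply, AddMonoidHom.coe_mulLeft, mono_mul_mono, hmono, map_mul,
      Finsupp.coe_add, Pi.add_apply, pow_add, Finset.prod_mul_distrib]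
    ring
  have hmul : ∀ p q, e (p * q) = e p * e q := by
    intro p q
    refine DFunLike.congr_fun (eq_of_eq_on_mono
      (φ := e.comp (AddMonoidHom.mulRight q))
      (ψ := (AddMonoidHom.mulRight (e q)).comp e)
      (he.comp (continuous_mul_const _)) ((continuous_mul_const _).comp he) fun μ b => ?_) p
    exact hmul1 μ b q
  have hconst : ∀ a, e (const T a) = f a := fun a => by
    rw [← mono_zero_eq_const, hmono]
    simp
  have hone : e 1 = 1 := by rw [← map_one (const T), hconst, map_one]
  refine ⟨{ e with map_one' := hone, map_mul' := hmul }, he, RingHom.ext hconst, fun i => ?_⟩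
  change e (var T i) = c i
  rw [← mono_single_eq_var, hmono, map_one, one_mul, Finset.prod_eq_single i]
  · simp
  · intro j _ hj
    simp [Finsupp.single_eq_of_ne hj]
  · simp

end Evaluation

end Restricted

/-! ### Topological generation -/

section TopGen

open Filter

variable {A B C : Type u} [CommRing A] [TopologicalSpace A] [NonarchimedeanRing A]
  [CommRing B] [TopologicalSpace B] [NonarchimedeanRing B]
  [CommRing C] [TopologicalSpace C] [NonarchimedeanRing C]

/-- The image of an additive subgroup under a ring homomorphism. -/
abbrev img (φ : B →+* C) (U : Submodule ℤ B) : Submodule ℤ C :=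
  U.map φ.toIntAlgHom.toLinearMap

lemma mem_img {φ : B →+* C} {U : Submodule ℤ B} {b : B} (hb : b ∈ U) : φ b ∈ img φ U :=
  Submodule.mem_map_of_mem (f := φ.toIntAlgHom.toLinearMap) hb

lemma img_mul (φ : B →+* C) (U V : Submodule ℤ B) : img φ (U * V) = img φ U * img φ V :=
  Submodule.map_mul U V φ.toIntAlgHom

lemma img_comp (f : A →+* B) (φ : B →+* C) (U : Submodule ℤ A) :
    img (φ.comp f) U = img φ (img f U) :=
  Submodule.map_comp f.toIntAlgHom.toLinearMap φ.toIntAlgHom.toLinearMap U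

lemma img_mul_le {φ : B →+* C} {U : Submodule ℤ B} {M N : Submodule ℤ C}
    (h : ∀ u ∈ U, ∀ m ∈ M, φ u * m ∈ N) : img φ U * M ≤ N := by
  refine Submodule.mul_le.2 ?_
  rintro _ ⟨u, hu, rfl⟩ m hm
  exact h u hu m hm

/-- The closure of an additive subgroup. -/
def closureSubmodule (M : Submodule ℤ C) : Submodule ℤ C :=
  AddSubgroup.toIntSubmodule M.toAddSubgroup.topologicalClosure

lemma img_mul_le_closureSubmodule {φ : B →+* C} (hφ : Continuous φ) {X : Submodule ℤ B}
    {U : Submodule ℤ B} (hU : (U : Set B) ⊆ closure X) (R : Submodule ℤ C) :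
    img φ U * R ≤ closureSubmodule (img φ X * R) :=
  img_mul_le fun _ hu r hr =>
    map_mem_closure (f := fun x => φ x * r) (hφ.mul continuous_const) (hU hu) fun _ hx =>
      Submodule.mul_mem_mul (mem_img hx) hr

/-- The subring `R` of `C` topologically generates `C` over `B`: the sets `φ(U) · R`, for `U` an
open subgroup of `B`, have open closures, shrink to `0`, and their union is dense. For `C` complete
this means that `C` is a quotient of a ring of restricted power series over `B`, but the property
makes sense, and is stable under composition, without any completeness. -/
structure IsTopGen (φ : B →+* C) (R : Subalgebra ℤ C) : Prop where
  closure_mem_nhds : ∀ U : OpenSubmod B,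
    closure ((img φ U.1 * Subalgebra.toSubmodule R : Submodule ℤ C) : Set C) ∈ 𝓝 0
  exists_subset : ∀ W ∈ 𝓝 (0 : C), ∃ U : OpenSubmod B,
    ((img φ U.1 * Subalgebra.toSubmodule R : Submodule ℤ C) : Set C) ⊆ W
  dense : Dense ((img φ ⊤ * Subalgebra.toSubmodule R : Submodule ℤ C) : Set C)

lemma IsTopGen.id : IsTopGen (RingHom.id B) ⊥ := by
  have h : ∀ U : Submodule ℤ B,
      img (RingHom.id B) U * Subalgebra.toSubmodule (⊥ : Subalgebra ℤ B) = U := fun U => by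
    rw [Algebra.toSubmodule_bot, mul_one]
    exact Submodule.map_id U
  refine ⟨fun U => ?_, fun W hW => ?_, ?_⟩
  · rw [h]
    exact mem_of_superset U.mem_nhds subset_closure
  · obtain ⟨U, hU⟩ := exists_openSubmod hW
    exact ⟨U, by rwa [h]⟩
  · rw [h]
    exact dense_univ

lemma IsTopGen.comp {f : A →+* B} {φ : B →+* C} {R₁ : Subalgebra ℤ B} {R₂ : Subalgebra ℤ C}
    (h₂ : IsTopGen φ R₂) (h₁ : IsTopGen f R₁) (hφ : Continuous φ) :
    IsTopGen (φ.comp f) (R₁.map φ.toIntAlgHom ⊔ R₂) := by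
  have h : ∀ U : Submodule ℤ A,
      img (φ.comp f) U * Subalgebra.toSubmodule (R₁.map φ.toIntAlgHom ⊔ R₂) =
        img φ (img f U * Subalgebra.toSubmodule R₁) * Subalgebra.toSubmodule R₂ := fun U => by
    rw [← Subalgebra.mul_toSubmodule, img_comp, img_mul, mul_assoc]
    rfl
  refine ⟨fun U => ?_, fun W hW => ?_, ?_⟩
  · rw [h]
    let V : OpenSubmod B := ⟨closureSubmodule (img f U.1 * Subalgebra.toSubmodule R₁),
      isOpen_of_mem_nhds (h₁.closure_mem_nhds U)⟩
    have hV := img_mul_le_closureSubmodule hφ (X := img f U.1 * Subalgebra.toSubmodule R₁)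
      (U := V.1) le_rfl (Subalgebra.toSubmodule R₂)
    exact mem_of_superset (h₂.closure_mem_nhds V) (closure_minimal hV isClosed_closure)
  · obtain ⟨V, hV⟩ := h₂.exists_subset W hW
    obtain ⟨U, hU⟩ := h₁.exists_subset V.1 V.mem_nhds
    refine ⟨U, ?_⟩
    rw [h]
    exact Set.Subset.trans (show _ ≤ img φ V.1 * Subalgebra.toSubmodule R₂ from
      mul_le_mul' (Submodule.map_mono hU) le_rfl) hV
  · rw [h]
    have hV := img_mul_le_closureSubmodule hφ (X := img f ⊤ * Subalgebra.toSubmodule R₁)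
      (U := ⊤) (fun x _ => h₁.dense x) (Subalgebra.toSubmodule R₂)
    exact dense_closure.1 (h₂.dense.mono hV)

/-- The subring generated by the elements `f(t) cᵢ`, for `t ∈ Tᵢ`. -/
def genAlg {n : ℕ} (f : A →+* C) (T : Weights A n) (c : Fin n → C) : Subalgebra ℤ C :=
  Algebra.adjoin ℤ {x | ∃ i, ∃ t ∈ T.set i, x = f t * c i}

lemma mul_mem_genAlg {n : ℕ} {f : A →+* C} {T : Weights A n} {c : Fin n → C} {i : Fin n} {t : A}
    (ht : t ∈ T.set i) : f t * c i ∈ genAlg f T c :=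
  Algebra.subset_adjoin ⟨i, t, ht, rfl⟩

/-- As `1` is a combination of the elements of `Tᵢ`, the element `v cᵢ` is, for small `v`, a
combination of the `f(t) cᵢ` with small coefficients. -/
lemma exists_forall_mul_gen_mem {n : ℕ} {f : A →+* B} {φ : B →+* C} (T : Weights A n)
    (c : Fin n → C) (i : Fin n) (U : OpenSubmod B) :
    ∃ V : OpenSubmod B, ∀ v ∈ V.1,
      φ v * c i ∈ img φ U.1 * Subalgebra.toSubmodule (genAlg (φ.comp f) T c) := by
  obtain ⟨a, -, ha⟩ := Submodule.mem_span_finset.1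
    (show (1 : A) ∈ Submodule.span A (T.set i : Set A) from by
      have : (1 : A) ∈ Ideal.span (T.set i : Set A) := by rw [T.span_eq_top]; trivial
      exact this)
  obtain ⟨V, hV⟩ := exists_forall_mul_le (T.set i) (fun t => f (a t)) (fun _ => U)
  refine ⟨V, fun v hv => ?_⟩
  have h1 : φ v * c i = ∑ t ∈ T.set i, φ (f (a t) * v) * ((φ.comp f) t * c i) := by
    conv_lhs => rw [← one_mul v, ← map_one f, ← ha, map_sum, Finset.sum_mul, map_sum,
      Finset.sum_mul]
    refine Finset.sum_congr rfl fun t _ => ?_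
    simp only [smul_eq_mul, map_mul, RingHom.comp_apply]
    ring
  rw [h1]
  exact Submodule.sum_mem _ fun t ht =>
    Submodule.mul_mem_mul (mem_img (hV t ht v hv)) (mul_mem_genAlg ht)

lemma gen_mem_range_sup_genAlg {n : ℕ} {f : A →+* B} {φ : B →+* C} (T : Weights A n)
    (c : Fin n → C) (i : Fin n) :
    c i ∈ φ.toIntAlgHom.range ⊔ genAlg (φ.comp f) T c := by
  obtain ⟨a, -, ha⟩ := Submodule.mem_span_finset.1
    (show (1 : A) ∈ Submodule.span A (T.set i : Set A) from by
      have : (1 : A) ∈ Ideal.span (T.set i : Set A) := by rw [T.span_eq_top]; trivial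
      exact this)
  have h1 : c i = ∑ t ∈ T.set i, φ (f (a t)) * ((φ.comp f) t * c i) := by
    conv_lhs => rw [← one_mul (c i), ← map_one (φ.comp f), ← ha, map_sum, Finset.sum_mul]
    refine Finset.sum_congr rfl fun t _ => ?_
    simp only [smul_eq_mul, map_mul, RingHom.comp_apply]
    ring
  rw [h1]
  exact Subalgebra.sum_mem _ fun t ht => mul_mem
    ((le_sup_left : φ.toIntAlgHom.range ≤ _) ⟨f (a t), rfl⟩)
    ((le_sup_right : genAlg (φ.comp f) T c ≤ _) (mul_mem_genAlg ht))

lemma img_top_mul (φ : B →+* C) (R : Subalgebra ℤ C) :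
    img φ ⊤ * Subalgebra.toSubmodule R = Subalgebra.toSubmodule (φ.toIntAlgHom.range ⊔ R) := by
  rw [← Subalgebra.mul_toSubmodule]
  congr 1
  exact Submodule.map_top _

/-- `B → C` is topologically of finite type, with weights taken from a ring `A` over which `B`
lies. -/
def IsTopFiniteType (f : A →+* B) (φ : B →+* C) : Prop :=
  ∃ (n : ℕ) (T : Weights A n) (c : Fin n → C), IsTopGen φ (genAlg (φ.comp f) T c)

/-- The concatenation of two families of weights. -/
def Weights.append {m n : ℕ} (T : Weights A m) (T' : Weights A n) : Weights A (m + n) where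
  set := Fin.append T.set T'.set
  span_eq_top i := by
    refine Fin.addCases (fun i => ?_) (fun i => ?_) i
    · rw [Fin.append_left]; exact T.span_eq_top i
    · rw [Fin.append_right]; exact T'.span_eq_top i

lemma genAlg_append {m n : ℕ} {f : A →+* B} {φ : B →+* C} (T : Weights A m) (T' : Weights A n)
    (b : Fin m → B) (c : Fin n → C) :
    genAlg (φ.comp f) (T.append T') (Fin.append (φ ∘ b) c) =
      (genAlg f T b).map φ.toIntAlgHom ⊔ genAlg (φ.comp f) T' c := by
  rw [genAlg, genAlg, genAlg, AlgHom.map_adjoin, ← Algebra.adjoin_union]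
  congr 1
  ext x
  constructor
  · rintro ⟨i, t, ht, rfl⟩
    revert ht
    refine Fin.addCases (fun i ht => ?_) (fun i ht => ?_) i
    · replace ht : t ∈ T.set i := by simpa [Weights.append] using ht
      exact Or.inl ⟨f t * b i, ⟨i, t, ht, rfl⟩, by simp⟩
    · replace ht : t ∈ T'.set i := by simpa [Weights.append] using ht
      exact Or.inr ⟨i, t, ht, by simp⟩
  · rintro (⟨_, ⟨i, t, ht, rfl⟩, rfl⟩ | ⟨i, t, ht, rfl⟩)
    · exact ⟨Fin.castAdd n i, t, by simpa [Weights.append] using ht, by simp⟩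
    · exact ⟨Fin.natAdd m i, t, by simpa [Weights.append] using ht, by simp⟩

lemma IsTopFiniteType.id : IsTopFiniteType (RingHom.id A) (RingHom.id A) := by
  refine ⟨0, Weights.one A 0, Fin.elim0, ?_⟩
  have : genAlg ((RingHom.id A).comp (RingHom.id A)) (Weights.one A 0) Fin.elim0 = ⊥ := by
    rw [genAlg, ← Algebra.adjoin_empty]
    congr 1
    ext x
    simp
  rw [this]
  exact .id

lemma IsTopFiniteType.comp {f : A →+* B} {φ : B →+* C}
    (h₂ : IsTopFiniteType f φ) (h₁ : IsTopFiniteType (RingHom.id A) f) (hφ : Continuous φ) :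
    IsTopFiniteType (RingHom.id A) (φ.comp f) := by
  obtain ⟨m, T, b, hb⟩ := h₁
  obtain ⟨n, T', c, hc⟩ := h₂
  refine ⟨m + n, T.append T', Fin.append (φ ∘ b) c, ?_⟩
  rw [RingHom.comp_id] at hb ⊢
  rw [genAlg_append]
  exact hc.comp hb hφ

section Presentation

variable {n : ℕ} {T : Weights A n}

lemma mul_mem_restrictedNhd {V : OpenSubmod A} {p q : restricted T}
    (hq : ∀ ν, MvPowerSeries.coeff ν q.1 ∈ T.pow ν) (hp : p ∈ restrictedNhd T V) :
    q * p ∈ restrictedNhd T V := by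
  classical
  intro ν
  change MvPowerSeries.coeff ν (q.1 * p.1) ∈ T.pow ν * V.1
  rw [MvPowerSeries.coeff_mul]
  refine Submodule.sum_mem _ fun x hx => ?_
  have hx' : x.1 + x.2 = ν := by simpa using hx
  rw [← hx', T.pow_add, mul_assoc]
  exact Submodule.mul_mem_mul (hq _) (hp _)

lemma map_mono (ψ : restricted T →+* C) (ν : Fin n →₀ ℕ) (a : A) :
    ψ (mono T ν a) = ψ (const T a) * ∏ i, ψ (var T i) ^ ν i := by
  rw [mono_eq_const_mul_prod, map_mul, map_prod]
  simp only [map_pow]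

lemma map_mul_prod_mem_genAlg (f : A →+* C) (c : Fin n → C) (ν : Fin n →₀ ℕ) {s : A}
    (hs : s ∈ T.pow ν) : f s * ∏ i, c i ^ ν i ∈ genAlg f T c := by
  induction ν using Finsupp.induction_linear generalizing s with
  | zero =>
    rw [Weights.pow_zero] at hs
    obtain ⟨k, rfl⟩ := Submodule.mem_one.1 hs
    simp
  | add μ ν hμ hν =>
    rw [Weights.pow_add] at hs
    induction hs using Submodule.mul_induction_on' with
    | mem_mul_mem x hx y hy =>
      have := mul_mem (hμ hx) (hν hy)
      convert this using 1
      simp only [map_mul, Finsupp.coe_add, Pi.add_apply, pow_add, Finset.prod_mul_distrib]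
      ring
    | add x _ y _ hx hy => rw [map_add, add_mul]; exact add_mem hx hy
  | single i k =>
    have hprod : ∀ k, ∏ j, c j ^ (Finsupp.single i k j) = c i ^ k := fun k => by
      rw [Finset.prod_eq_single i]
      · simp
      · intro j _ hj
        simp [Finsupp.single_eq_of_ne hj]
      · simp
    rw [hprod]
    induction k generalizing s with
    | zero =>
      rw [Finsupp.single_zero, Weights.pow_zero] at hs
      obtain ⟨k, rfl⟩ := Submodule.mem_one.1 hs
      simp
    | succ k ih =>
      rw [Finsupp.single_add, Weights.pow_add, Weights.pow_single] at hs
      induction hs using Submodule.mul_induction_on' with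
      | mem_mul_mem x hx y hy =>
        have hy' : f y * c i ∈ genAlg f T c := by
          induction hy using Submodule.span_induction with
          | mem t ht => exact mul_mem_genAlg ht
          | zero => simp
          | add y z _ _ hy hz => rw [map_add, add_mul]; exact add_mem hy hz
          | smul m y _ hy =>
            rw [map_zsmul, smul_mul_assoc]
            exact zsmul_mem hy m
        have := mul_mem (ih hx) hy'
        convert this using 1
        rw [map_mul, pow_succ]
        ring
      | add x _ y _ hx hy => rw [map_add, add_mul]; exact add_mem hx hy

lemma map_mul_prod_mem_img_mul (f : A →+* C) (c : Fin n → C) (ν : Fin n →₀ ℕ) {U : Submodule ℤ A}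
    {a : A} (ha : a ∈ T.pow ν * U) :
    f a * ∏ i, c i ^ ν i ∈ img f U * Subalgebra.toSubmodule (genAlg f T c) := by
  induction ha using Submodule.mul_induction_on' with
  | mem_mul_mem x hx y hy =>
    have := Submodule.mul_mem_mul (mem_img (φ := f) hy)
      (show f x * ∏ i, c i ^ ν i ∈ Subalgebra.toSubmodule (genAlg f T c) from
        map_mul_prod_mem_genAlg f c ν hx)
    convert this using 1
    rw [map_mul]
    ring
  | add x _ y _ hx hy => rw [map_add, add_mul]; exact add_mem hx hy

lemma IsTopGen.canEvaluate {f : A →+* C} {c : Fin n → C} (h : IsTopGen f (genAlg f T c)) :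
    CanEvaluate T f c := fun W hW => by
  obtain ⟨U, hU⟩ := h.exists_subset W hW
  exact ⟨U, fun ν a ha => hU (map_mul_prod_mem_img_mul f c ν ha)⟩

lemma img_mul_genAlg_subset_image (ψ : restricted T →+* C) (U : OpenSubmod A) :
    ((img (ψ.comp (const T)) U.1 * Subalgebra.toSubmodule
      (genAlg (ψ.comp (const T)) T fun i => ψ (var T i)) : Submodule ℤ C) : Set C) ⊆
      ψ '' (restrictedNhd T U) := by
  classical
  let N : Submodule ℤ C :=
    AddSubgroup.toIntSubmodule ((restrictedNhd T U).map (ψ : restricted T →+ C))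
  have hgen : ∀ r ∈ genAlg (ψ.comp (const T)) T fun i => ψ (var T i), ∀ x ∈ N, x * r ∈ N := by
    intro r hr
    induction hr using Algebra.adjoin_induction with
    | mem r hr =>
      obtain ⟨i, t, ht, rfl⟩ := hr
      rintro _ ⟨p, hp, rfl⟩
      refine ⟨mono T (Finsupp.single i 1) t * p, mul_mem_restrictedNhd (fun ν => ?_) hp, ?_⟩
      · rw [coeff_mono]
        split_ifs with h
        · rw [h, Weights.pow_single]
          exact Submodule.subset_span ht
        · exact Submodule.zero_mem _
      · have : mono T (Finsupp.single i 1) t = const T t * var T i := by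
          rw [← mono_zero_eq_const, ← mono_single_eq_var, mono_mul_mono, zero_add, mul_one]
        rw [this]
        simp [mul_comm]
    | algebraMap k =>
      intro x hx
      have := N.smul_mem k hx
      rwa [zsmul_eq_mul, mul_comm] at this
    | add r s _ _ hr hs => intro x hx; rw [mul_add]; exact N.add_mem (hr x hx) (hs x hx)
    | mul r s _ _ hr hs => intro x hx; rw [← mul_assoc]; exact hs _ (hr x hx)
  refine (show _ ≤ N from img_mul_le fun u hu r hr => hgen r hr _ ⟨const T u, ?_, rfl⟩)
  rw [← mono_zero_eq_const]
  exact mono_mem_restrictedNhd (by rwa [Weights.pow_zero, one_mul])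

/-- A quotient of a ring of restricted power series is topologically generated by the images of
the variables. -/
lemma isTopGen_of_isOpenQuotientMap {ψ : restricted T →+* C} (hψ : IsOpenQuotientMap ψ) :
    IsTopGen (ψ.comp (const T)) (genAlg (ψ.comp (const T)) T fun i => ψ (var T i)) := by
  refine ⟨fun U => ?_, fun W hW => ?_, ?_⟩
  · have h1 : ψ '' (restrictedNhd T U) ∈ 𝓝 (0 : C) := by
      have := hψ.isOpenMap.image_mem_nhds
        ((isOpen_restrictedNhd (T := T) U).mem_nhds (zero_mem _))
      rwa [map_zero] at this
    refine mem_of_superset h1 ?_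
    rintro _ ⟨p, hp, rfl⟩
    let S : AddSubgroup (restricted T) :=
      (closureSubmodule (img (ψ.comp (const T)) U.1 * Subalgebra.toSubmodule
        (genAlg (ψ.comp (const T)) T fun i => ψ (var T i)))).toAddSubgroup.comap
          (ψ : restricted T →+ C)
    have hS : IsClosed (S : Set (restricted T)) := isClosed_closure.preimage hψ.continuous
    refine mem_of_mem_restrictedNhd (S := S) hS (fun ν a ha => ?_) hp
    refine subset_closure ?_
    change ψ (mono T ν a) ∈ _
    rw [map_mono]
    exact map_mul_prod_mem_img_mul _ _ ν ha
  · obtain ⟨U, -, hU⟩ := (restricted_hasBasis T).mem_iff.1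
      (hψ.continuous.continuousAt.preimage_mem_nhds (x := 0) (by rwa [map_zero]))
    exact ⟨U, (img_mul_genAlg_subset_image ψ U).trans (Set.image_subset_iff.2 hU)⟩
  · intro x
    obtain ⟨p, rfl⟩ := hψ.surjective x
    rw [img_top_mul]
    let S : AddSubgroup (restricted T) :=
      (closureSubmodule (Subalgebra.toSubmodule ((ψ.comp (const T)).toIntAlgHom.range ⊔
        genAlg (ψ.comp (const T)) T fun i => ψ (var T i)))).toAddSubgroup.comap
          (ψ : restricted T →+ C)
    have hS : IsClosed (S : Set (restricted T)) := isClosed_closure.preimage hψ.continuous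
    refine mem_of_mono_mem (S := S) hS (fun ν a => subset_closure ?_) p
    change ψ (mono T ν a) ∈ (ψ.comp (const T)).toIntAlgHom.range ⊔
        genAlg (ψ.comp (const T)) T fun i => ψ (var T i)
    rw [map_mono]
    refine mul_mem ((le_sup_left : (ψ.comp (const T)).toIntAlgHom.range ≤ _) ⟨a, rfl⟩)
      (prod_mem fun i _ => pow_mem ?_ _)
    exact gen_mem_range_sup_genAlg (f := RingHom.id A) (φ := ψ.comp (const T)) T
      (fun i => ψ (var T i)) i

/-- A complete ring that is topologically of finite type is a quotient of a ring of restricted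
power series. -/
theorem IsTopGen.exists_isOpenQuotientMap [T2Space A] [FirstCountableTopology A]
    (hA : IsCompleteGroup A) [T2Space C] (hC : IsCompleteGroup C) {f : A →+* C} {c : Fin n → C}
    (h : IsTopGen f (genAlg f T c)) :
    ∃ ψ : restricted T →+* C, IsOpenQuotientMap ψ ∧ ψ.comp (const T) = f := by
  obtain ⟨ψ, hψ, hψc, hψv⟩ := h.canEvaluate.exists_ringHom hC
  have hsub : ∀ U : OpenSubmod A, ((img f U.1 * Subalgebra.toSubmodule (genAlg f T c) :
      Submodule ℤ C) : Set C) ⊆ ψ '' (restrictedNhd T U) := fun U => by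
    have := img_mul_genAlg_subset_image ψ U
    simpa only [hψc, hψv] using this
  have hopen : IsOpenMap ψ := by
    refine isOpenMap_of_closure_image_mem_nhds (isCompleteGroup_restricted hA)
      (ψ : restricted T →+ C) hψ fun V => ?_
    obtain ⟨U, -, hU⟩ := (restricted_hasBasis T).mem_iff.1 V.mem_nhds_zero
    exact mem_of_superset (h.closure_mem_nhds U)
      (closure_mono ((hsub U).trans (Set.image_mono hU)))
  refine ⟨ψ, ⟨fun x => ?_, hψ, hopen⟩, hψc⟩
  have hcl : IsClosed (ψ.range.toAddSubgroup : Set C) :=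
    AddSubgroup.isClosed_of_isOpen _ hopen.isOpen_range
  refine closure_minimal ?_ hcl (h.dense x)
  exact (hsub ⟨⊤, isOpen_univ⟩).trans (Set.image_subset_range _ _)

end Presentation

end TopGen

/-! ### Analytic rings and boundedness -/

section Analytic

open Filter

variable {A B C : Type u} [CommRing A] [TopologicalSpace A] [NonarchimedeanRing A]
  [CommRing B] [TopologicalSpace B] [NonarchimedeanRing B]
  [CommRing C] [TopologicalSpace C] [NonarchimedeanRing C]

/-- The topologically nilpotent elements generate the unit ideal. -/
def IsAnalyticRing (A : Type u) [CommRing A] [TopologicalSpace A] : Prop :=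
  Ideal.span {a : A | IsTopologicallyNilpotent a} = ⊤

lemma IsAnalyticRing.map (hA : IsAnalyticRing A) {f : A →+* B} (hf : Continuous f) :
    IsAnalyticRing B := by
  have h := congrArg (Ideal.map f) hA
  rw [Ideal.map_span, Ideal.map_top] at h
  refine top_le_iff.1 (h ▸ Ideal.span_mono ?_)
  rintro _ ⟨a, ha, rfl⟩
  exact IsTopologicallyNilpotent.map hf ha

/-- In an analytic ring, finitely many arbitrarily small elements generate the unit ideal. -/
lemma IsAnalyticRing.exists_finset (hA : IsAnalyticRing A) {S : Set A} (hS : S ∈ 𝓝 (0 : A)) :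
    ∃ T : Finset A, (T : Set A) ⊆ S ∧ Ideal.span (T : Set A) = ⊤ := by
  classical
  obtain ⟨F, hF, h1⟩ := Submodule.mem_span_finite_of_mem_span
    (show (1 : A) ∈ Submodule.span A {a : A | IsTopologicallyNilpotent a} from
      (Ideal.eq_top_iff_one _).1 hA)
  have hn : ∀ᶠ k in atTop, ∀ t ∈ F, t ^ k ∈ S :=
    (Finset.eventually_all F).2 fun t ht => (hF ht : Tendsto _ _ _).eventually_mem hS
  obtain ⟨k, hk⟩ := hn.exists
  refine ⟨F.image (· ^ k), ?_, ?_⟩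
  · rw [Finset.coe_image]
    rintro _ ⟨t, ht, rfl⟩
    exact hk t ht
  · rw [Finset.coe_image]
    exact Ideal.span_pow_eq_top _ ((Ideal.eq_top_iff_one _).2 h1) k

/-- There is an open bounded subring. -/
def HasBoundedOpenSubring (A : Type u) [CommRing A] [TopologicalSpace A] : Prop :=
  ∃ S : Subring A, IsOpen (S : Set A) ∧ IsBoundedSubset (S : Set A)

/-- The closure of `f(A₀) · R` is an open bounded subring of `B`, for `A₀` one of `A`. -/
lemma IsTopGen.hasBoundedOpenSubring {f : A →+* B} {R : Subalgebra ℤ B} (h : IsTopGen f R)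
    (hA : HasBoundedOpenSubring A) : HasBoundedOpenSubring B := by
  obtain ⟨A₀, hA₀, hb⟩ := hA
  let M : Subalgebra ℤ B := (subalgebraOfSubring A₀).map f.toIntAlgHom ⊔ R
  let U₀ : OpenSubmod A := ⟨AddSubgroup.toIntSubmodule A₀.toAddSubgroup, hA₀⟩
  have hM : Subalgebra.toSubmodule M = img f U₀.1 * Subalgebra.toSubmodule R := by
    rw [← Subalgebra.mul_toSubmodule]
    rfl
  have hM' : (M : Set B) = (img f U₀.1 * Subalgebra.toSubmodule R : Submodule ℤ B) :=
    congrArg (fun N : Submodule ℤ B => (N : Set B)) hM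
  have hMn : closure (M : Set B) ∈ 𝓝 (0 : B) := by
    rw [hM']
    exact h.closure_mem_nhds U₀
  refine ⟨M.toSubring.topologicalClosure,
    AddSubgroup.isOpen_of_mem_nhds M.toSubring.topologicalClosure.toAddSubgroup (g := 0) hMn,
    fun W hW => ?_⟩
  obtain ⟨W', hW'⟩ := exists_openSubmod hW
  obtain ⟨U, hU⟩ := h.exists_subset _ W'.mem_nhds
  obtain ⟨V, hV, hVA⟩ := hb U.1 U.mem_nhds
  obtain ⟨V', hV'⟩ := exists_openSubmod hV
  refine ⟨_, h.closure_mem_nhds V', fun v hv s hs => hW' ?_⟩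
  have hcl : IsClosed (W'.1 : Set B) :=
    AddSubgroup.isClosed_of_isOpen W'.1.toAddSubgroup W'.2
  rw [← hcl.closure_eq]
  refine map_mem_closure₂ continuous_mul hv hs fun x hx y hy => hU ?_
  have hy' : y ∈ img f U₀.1 * Subalgebra.toSubmodule R := by
    rw [← hM]
    exact hy
  have h1 := Submodule.mul_mem_mul hx hy'
  rw [mul_mul_mul_comm, Subalgebra.mul_toSubmodule, sup_idem, ← img_mul] at h1
  refine (mul_le_mul' (Submodule.map_mono ?_) le_rfl :
    _ ≤ img f U.1 * Subalgebra.toSubmodule R) h1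
  exact Submodule.mul_le.2 fun v hv a ha => hVA v (hV' hv) a ha

/-- A finite algebra with the module topology is topologically of finite type: if `bᵢ` are module
generators and the elements of `T` are so small that they multiply the structure constants
into an open bounded subring `B₀`, then the products of the `t bᵢ` stay in the bounded subgroup
`ℤ + ∑ B₀ bᵢ`. -/
lemma isTopFiniteType_of_finite (hA : IsAnalyticRing A) {f : A →+* B} (hf : Continuous f)
    (hB : HasBoundedOpenSubring B) [Algebra B C] [Module.Finite B C] [IsModuleTopology B C] :
    IsTopFiniteType f (algebraMap B C) := by
  obtain ⟨B₀, hB₀, hb⟩ := hB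
  obtain ⟨k, b, hspan⟩ := Module.Finite.exists_fin (R := B) (M := C)
  have hrep : ∀ x : C, ∃ β : Fin k → B, ∑ l, β l • b l = x := fun x =>
    (Submodule.mem_span_range_iff_exists_fun B).1 (hspan ▸ Submodule.mem_top)
  choose c hc using fun i j => hrep (b i * b j)
  have hB₀n : (B₀ : Set B) ∈ 𝓝 (0 : B) := hB₀.mem_nhds B₀.zero_mem
  have hsmall : {a : A | f a ∈ B₀ ∧ ∀ i j l, f a * c i j l ∈ B₀} ∈ 𝓝 (0 : A) := by
    refine Filter.inter_mem (hf.continuousAt.preimage_mem_nhds (by rwa [map_zero])) ?_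
    have : ∀ i j l, {a : A | f a * c i j l ∈ B₀} ∈ 𝓝 (0 : A) := fun i j l =>
      (hf.mul continuous_const).continuousAt.preimage_mem_nhds (by simpa using hB₀n)
    have := (iInter_mem.2 fun i => iInter_mem.2 fun j => iInter_mem.2 fun l => this i j l)
    refine mem_of_superset this fun a ha => ?_
    simp only [Set.mem_iInter] at ha
    exact fun i j l => ha i j l
  obtain ⟨T, hT, hT1⟩ := hA.exists_finset hsmall
  let φ : B →+* C := algebraMap B C
  have hφ : Continuous φ := by
    have h1 : (φ : B → C) = fun a => a • (1 : C) := funext fun a => Algebra.algebraMap_eq_smul_one a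
    rw [h1]
    exact continuous_id.smul continuous_const
  let W : Weights A k := ⟨fun _ => T, fun _ => hT1⟩
  refine ⟨k, W, b, ?_⟩
  change IsTopGen φ (genAlg (φ.comp f) W b)
  refine ⟨fun U => ?_, fun S hS => ?_, ?_⟩
  · let L : (Fin k → B) →ₗ[B] C := Fintype.linearCombination B b
    have hL : Function.Surjective L := fun x => hrep x
    have hLo : IsOpenMap L := (IsModuleTopology.isOpenQuotientMap_of_surjective hL).isOpenMap
    choose V hV using fun i => exists_forall_mul_gen_mem (f := f) (φ := φ) W b i U
    have hn : Set.univ.pi (fun i => ((V i).1 : Set B)) ∈ 𝓝 (0 : Fin k → B) :=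
      set_pi_mem_nhds Set.finite_univ fun i _ => (V i).mem_nhds
    have h1 := hLo.image_mem_nhds hn
    rw [map_zero] at h1
    refine mem_of_superset h1 (Set.Subset.trans ?_ subset_closure)
    rintro _ ⟨x, hx, rfl⟩
    change ∑ i, x i • b i ∈ _
    refine Submodule.sum_mem _ fun i _ => ?_
    rw [Algebra.smul_def]
    exact hV i _ (hx i trivial)
  · obtain ⟨S', hS'⟩ := exists_openSubmod hS
    have hn : ∀ l, {β : B | φ β * b l ∈ S'.1} ∈ 𝓝 (0 : B) := fun l =>
      (hφ.mul continuous_const).continuousAt.preimage_mem_nhds (by simpa using S'.mem_nhds)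
    obtain ⟨V, hV, hVB⟩ := hb _ (iInter_mem.2 hn)
    obtain ⟨U, hU⟩ := exists_openSubmod (inter_mem hV
      (hφ.continuousAt.preimage_mem_nhds (x := 0) (by rw [map_zero]; exact S'.mem_nhds)))
    refine ⟨U, Set.Subset.trans ?_ hS'⟩
    let M : Submodule ℤ C := Submodule.span ℤ ({1} ∪ {x | ∃ β ∈ B₀, ∃ l, x = φ β * b l})
    have hM1 : (1 : C) ∈ M := Submodule.subset_span (Or.inl rfl)
    have hMb : ∀ β ∈ B₀, ∀ l, φ β * b l ∈ M := fun β hβ l =>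
      Submodule.subset_span (Or.inr ⟨β, hβ, l, rfl⟩)
    have hMR : ∀ r ∈ genAlg (φ.comp f) W b, ∀ x ∈ M, x * r ∈ M := by
      intro r hr
      induction hr using Algebra.adjoin_induction with
      | mem r hr =>
        obtain ⟨i, t, ht, rfl⟩ := hr
        intro x hx
        induction hx using Submodule.span_induction with
        | mem x hx =>
          obtain rfl | ⟨β, hβ, l, rfl⟩ := hx
          · rw [one_mul]
            exact hMb _ (hT ht).1 i
          · have : φ β * b l * ((φ.comp f) t * b i) =
                ∑ m, φ (β * (f t * c l i m)) * b m := by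
              calc φ β * b l * ((φ.comp f) t * b i) = φ (β * f t) * (b l * b i) := by
                    rw [map_mul, RingHom.comp_apply]; ring
                _ = _ := by
                    rw [← hc l i, Finset.mul_sum]
                    refine Finset.sum_congr rfl fun m _ => ?_
                    rw [Algebra.smul_def, ← mul_assoc, ← map_mul, mul_assoc]
            rw [this]
            exact Submodule.sum_mem _ fun m _ => hMb _ (B₀.mul_mem hβ ((hT ht).2 l i m)) m
        | zero => simp
        | add x y _ _ hx hy => rw [add_mul]; exact M.add_mem hx hy
        | smul m x _ hx => rw [smul_mul_assoc]; exact M.smul_mem m hx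
      | algebraMap m =>
        intro x hx
        have := M.smul_mem m hx
        rwa [zsmul_eq_mul, mul_comm] at this
      | add r s _ _ hr hs => intro x hx; rw [mul_add]; exact M.add_mem (hr x hx) (hs x hx)
      | mul r s _ _ hr hs => intro x hx; rw [← mul_assoc]; exact hs _ (hr x hx)
    refine (show _ ≤ S'.1 from img_mul_le fun u hu r hr => ?_)
    have hr' : r ∈ M := by simpa using hMR r hr 1 hM1
    clear hr
    induction hr' using Submodule.span_induction with
    | mem x hx =>
      obtain rfl | ⟨β, hβ, l, rfl⟩ := hx
      · rw [mul_one]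
        exact (hU hu).2
      · rw [← mul_assoc, ← map_mul]
        exact Set.mem_iInter.1 (hVB u (hU hu).1 β hβ) l
    | zero => simp
    | add x y _ _ hx hy => rw [mul_add]; exact S'.1.add_mem hx hy
    | smul m x _ hx => rw [mul_smul_comm]; exact S'.1.smul_mem m hx
  · intro x
    refine subset_closure ?_
    rw [img_top_mul]
    obtain ⟨β, rfl⟩ := hrep x
    change _ ∈ φ.toIntAlgHom.range ⊔ genAlg (φ.comp f) W b
    refine sum_mem fun l _ => ?_
    rw [Algebra.smul_def]
    exact mul_mem ((le_sup_left : φ.toIntAlgHom.range ≤ _) ⟨β l, rfl⟩)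
      (gen_mem_range_sup_genAlg W b l)

end Analytic

/-! ### Composites of rational localizations and finite étale morphisms -/

section Composite

lemma IsRationalLocalizationAt.exists_isOpenQuotientMap {A B : RingPair.{u}} {D : RationalDatum A}
    {φ : A →+* B} (h : IsRationalLocalizationAt D φ) :
    ∃ ψ : restricted (Weights.one A D.n) →+* B, IsOpenQuotientMap ψ ∧
      ψ.comp (const (Weights.one A D.n)) = φ ∧
      RingHom.ker ψ = (Ideal.span (Set.range fun i =>
        const (Weights.one A D.n) D.den * var (Weights.one A D.n) i -
          const (Weights.one A D.n) (D.num i))).closure := by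
  obtain ⟨ψ, h1, h2, h3, h4, h5, -⟩ := h
  exact ⟨ψ, ⟨h4, h2, h3⟩, h1, h5⟩

lemma IsRationalLocalization.isTopFiniteType {A : Type u} [CommRing A] [TopologicalSpace A]
    [NonarchimedeanRing A] {B C : RingPair.{u}} {φ : B →+* C} (h : IsRationalLocalization φ)
    (f : A →+* B) : IsTopFiniteType f φ := by
  obtain ⟨D, hD⟩ := h
  obtain ⟨ψ, hψ, rfl, -⟩ := hD.exists_isOpenQuotientMap
  refine ⟨D.n, Weights.one A D.n, fun i => ψ (var _ i), ?_⟩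
  have h1 := isTopGen_of_isOpenQuotientMap hψ
  have h2 : ∀ (R : Type u) [CommRing R] (g : R →+* C) (c : Fin D.n → C),
      genAlg g (Weights.one R D.n) c = Algebra.adjoin ℤ (Set.range c) := fun R _ g c => by
    rw [genAlg]
    congr 1
    ext x
    simp [Weights.one, eq_comm]
  rw [h2] at h1 ⊢
  exact h1

lemma IsFiniteEtale.continuous {A B : RingPair.{u}} {φ : A →+* B} (h : IsFiniteEtale φ) :
    Continuous φ := by
  let := φ.toAlgebra
  have : IsModuleTopology A B := h.topology
  have h1 : (φ : A → B) = fun a => a • (1 : B) := funext fun a => Algebra.algebraMap_eq_smul_one a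
  rw [h1]
  exact continuous_id.smul continuous_const

lemma IsComposite.continuous {A B : RingPair.{u}} {φ : A →+* B} (h : IsComposite φ) :
    Continuous φ := by
  induction h with
  | rational h =>
    obtain ⟨D, hD⟩ := h
    obtain ⟨ψ, hψ, rfl, -⟩ := hD.exists_isOpenQuotientMap
    exact hψ.continuous.comp continuous_constHom
  | finiteEtale h => exact h.continuous
  | comp _ _ h₁ h₂ => exact h₂.comp h₁

lemma IsComposite.isTopFiniteType {A : Type u} [CommRing A] [TopologicalSpace A]
    [NonarchimedeanRing A] (hA : IsAnalyticRing A) (hA₀ : HasBoundedOpenSubring A)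
    {B C : RingPair.{u}} {φ : B →+* C} (h : IsComposite φ) {f : A →+* B} (hf : Continuous f)
    (hft : IsTopFiniteType (RingHom.id A) f) : IsTopFiniteType (RingHom.id A) (φ.comp f) := by
  induction h with
  | rational h => exact (h.isTopFiniteType f).comp hft (IsComposite.rational h).continuous
  | @finiteEtale B C φ h =>
    refine IsTopFiniteType.comp ?_ hft h.continuous
    obtain ⟨n, T, c, hT⟩ := hft
    have hB := hT.hasBoundedOpenSubring hA₀
    let := φ.toAlgebra
    have : IsModuleTopology B C := h.topology
    have : Module.Finite B C := h.finite
    exact isTopFiniteType_of_finite hA hf hB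
  | comp h₁ _ ih₁ ih₂ => exact ih₂ (h₁.continuous.comp hf) (ih₁ hf hft)

end Composite

/-! ### Lifting power-bounded elements along square-zero extensions -/

section PowerBounded

open Filter

variable {B C E : Type u} [CommRing B] [TopologicalSpace B] [NonarchimedeanRing B]
  [CommRing C] [TopologicalSpace C] [NonarchimedeanRing C]
  [CommRing E] [TopologicalSpace E] [NonarchimedeanRing E]

lemma IsBoundedSubset.mul {S T : Set E} (hS : IsBoundedSubset S) (hT : IsBoundedSubset T) :
    IsBoundedSubset (S * T) := fun W hW => by
  obtain ⟨V, hV, hVT⟩ := hT W hW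
  obtain ⟨V', hV', hVS⟩ := hS V hV
  refine ⟨V', hV', fun v hv => ?_⟩
  rintro _ ⟨s, hs, t, ht, rfl⟩
  change v * (s * t) ∈ W
  rw [← mul_assoc]
  exact hVT _ (hVS v hv s hs) t ht

lemma isBoundedSubset_monomials {n : ℕ} {e : Fin n → E} (he : ∀ i, IsPowerBounded (e i)) :
    IsBoundedSubset (Set.range fun ν : Fin n →₀ ℕ => ∏ i, e i ^ ν i) := by
  suffices h : ∀ s : Finset (Fin n),
      IsBoundedSubset (Set.range fun ν : Fin n →₀ ℕ => ∏ i ∈ s, e i ^ ν i) from h Finset.univ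
  classical
  intro s
  induction s using Finset.induction_on with
  | empty =>
    intro W hW
    refine ⟨W, hW, fun v hv => ?_⟩
    rintro _ ⟨ν, rfl⟩
    simpa using hv
  | insert i s hi ih =>
    intro W hW
    obtain ⟨V, hV, h⟩ := (he i).mul ih W hW
    refine ⟨V, hV, fun v hv => ?_⟩
    rintro _ ⟨ν, rfl⟩
    refine h v hv _ ?_
    dsimp only
    rw [Finset.prod_insert hi]
    exact Set.mul_mem_mul ⟨ν i, rfl⟩ ⟨ν, rfl⟩

/-- Along an extension `E → C` with square-zero kernel, `e` is power-bounded as soon as the powers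
of its image have lifts `yₖ` in a bounded set. Indeed, the elements `mₖ = e yₖ₋₁ - yₖ` lie in the
kernel, on which `e` acts like any other lift of its image, so that `e ^ k - yₖ` is a sum of
elements `yⱼ mₗ`. -/
lemma isPowerBounded_of_lifts {π : E →+* C}
    (hsq : ∀ x ∈ RingHom.ker π, ∀ y ∈ RingHom.ker π, x * y = 0) {S : Set E}
    (hS : IsBoundedSubset S) {e : E} (h : ∀ k : ℕ, ∃ y ∈ S, π y = π e ^ k) : IsPowerBounded e := by
  choose y hyS hy using h
  let m : ℕ → E := fun k => Nat.casesOn k (1 - y 0) fun l => e * y l - y (l + 1)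
  have hm : ∀ l, m l ∈ RingHom.ker π := by
    rintro (_ | l)
    · change π (1 - y 0) = 0
      rw [map_sub, map_one, hy, pow_zero, sub_self]
    · change π (e * y l - y (l + 1)) = 0
      rw [map_sub, map_mul, hy, hy, pow_succ', sub_self]
  let N : Submodule ℤ E := Submodule.span ℤ {x | ∃ j l, x = y j * m l}
  have hN : ∀ j l, y j * m l ∈ N := fun j l => Submodule.subset_span ⟨j, l, rfl⟩
  have hmN : ∀ l, m l ∈ N := fun l => by
    have h0 := hsq _ (hm 0) _ (hm l)
    have h1 : m l = y 0 * m l := by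
      change (1 - y 0) * m l = 0 at h0
      linear_combination h0
    rw [h1]
    exact hN 0 l
  have heN : ∀ x ∈ N, e * x ∈ N := by
    intro x hx
    induction hx using Submodule.span_induction with
    | mem x hx =>
      obtain ⟨j, l, rfl⟩ := hx
      have h0 := hsq _ (hm (j + 1)) _ (hm l)
      have h1 : e * (y j * m l) = y (j + 1) * m l := by
        change (e * y j - y (j + 1)) * m l = 0 at h0
        linear_combination h0
      rw [h1]
      exact hN _ _
    | zero => simp
    | add x z _ _ hx hz => rw [mul_add]; exact N.add_mem hx hz
    | smul k x _ hx => rw [mul_smul_comm]; exact N.smul_mem k hx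
  have hpow : ∀ k, e ^ k - y k ∈ N := by
    intro k
    induction k with
    | zero =>
      rw [pow_zero]
      exact hmN 0
    | succ k ih =>
      have h1 : e ^ (k + 1) - y (k + 1) = e * (e ^ k - y k) + m (k + 1) := by
        change _ = e * (e ^ k - y k) + (e * y k - y (k + 1))
        ring
      rw [h1]
      exact N.add_mem (heN _ ih) (hmN (k + 1))
  intro W hW
  obtain ⟨W', hW'⟩ := exists_openSubmod hW
  obtain ⟨V₁, hV₁, hV₁S⟩ := hS _ W'.mem_nhds
  obtain ⟨V₂, hV₂⟩ := exists_openSubmod hV₁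
  obtain ⟨V₃, hV₃⟩ := exists_mul_le e V₂
  obtain ⟨V₄, hV₄⟩ := exists_openSubmod (inter_mem V₂.mem_nhds V₃.mem_nhds)
  obtain ⟨V₅, hV₅, hV₅S⟩ := hS _ V₄.mem_nhds
  refine ⟨V₁ ∩ V₅, inter_mem hV₁ hV₅, fun v hv => ?_⟩
  rintro _ ⟨k, rfl⟩
  apply hW'
  have hvN : ∀ x ∈ N, v * x ∈ W'.1 := by
    intro x hx
    induction hx using Submodule.span_induction with
    | mem x hx =>
      obtain ⟨j, l, rfl⟩ := hx
      have h4 := hV₄ (hV₅S v hv.2 (y j) (hyS j))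
      rw [← mul_assoc]
      cases l with
      | zero =>
        change v * y j * (1 - y 0) ∈ W'.1
        rw [mul_sub, mul_one]
        exact W'.1.sub_mem (hV₁S v hv.1 _ (hyS j)) (hV₁S _ (hV₂ h4.1) _ (hyS 0))
      | succ l =>
        change v * y j * (e * y l - y (l + 1)) ∈ W'.1
        rw [mul_sub, ← mul_assoc, mul_comm (v * y j) e]
        exact W'.1.sub_mem (hV₁S _ (hV₂ (hV₃ _ h4.2)) _ (hyS l))
          (hV₁S _ (hV₂ h4.1) _ (hyS _))
    | zero => simp
    | add x z _ _ hx hz => rw [mul_add]; exact W'.1.add_mem hx hz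
    | smul k x _ hx => rw [mul_smul_comm]; exact W'.1.smul_mem k hx
  have h1 : v * e ^ k = v * (e ^ k - y k) + v * y k := by ring
  change v * e ^ k ∈ W'.1
  rw [h1]
  exact W'.1.add_mem (hvN _ (hpow k)) (hV₁S v hv.1 _ (hyS k))

lemma isBoundedSubset_linearCombinations {ι : Type*} (s : Finset ι) (a : ι → E) {S : Set E}
    (hS : IsBoundedSubset S) :
    IsBoundedSubset {x | ∃ y : ι → E, (∀ t ∈ s, y t ∈ S) ∧ x = ∑ t ∈ s, a t * y t} := fun W hW => by
  obtain ⟨W', hW'⟩ := exists_openSubmod hW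
  obtain ⟨V, hV⟩ := exists_forall_mul_le s a (fun _ => W')
  obtain ⟨V', hV', hVS⟩ := hS _ V.mem_nhds
  refine ⟨V', hV', fun v hv => ?_⟩
  rintro _ ⟨y, hy, rfl⟩
  apply hW'
  rw [Finset.mul_sum]
  refine W'.1.sum_mem fun t ht => ?_
  rw [mul_left_comm]
  exact hV t ht _ (hVS v hv _ (hy t ht))

/-- The powers of the image in `C` of a variable of `B⟨X⟩` lift to a bounded subset of `E`: for
small `t` generating the unit ideal of `B`, the `t Xᵢ^k` lift to a bounded neighbourhood of `0`. -/
lemma exists_bounded_lifts (hB : IsAnalyticRing B) {n : ℕ}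
    {u : restricted (Weights.one B n) →+* C} (hu : Continuous u) {π : E →+* C} (hπ : IsOpenMap π)
    {v : B →+* E} (huv : π.comp v = u.comp (const _)) {S : Set E} (hS : S ∈ 𝓝 (0 : E))
    (hSb : IsBoundedSubset S) (i : Fin n) :
    ∃ S' : Set E, IsBoundedSubset S' ∧ ∀ k : ℕ, ∃ y ∈ S', π y = u (var _ i) ^ k := by
  have h1 : π '' S ∈ 𝓝 (0 : C) := by
    have := hπ.image_mem_nhds hS
    rwa [map_zero] at this
  obtain ⟨U, -, hU⟩ := (restricted_hasBasis _).mem_iff.1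
    (hu.continuousAt.preimage_mem_nhds (x := 0) (by rwa [map_zero]))
  obtain ⟨T, hT, hT1⟩ := hB.exists_finset U.mem_nhds
  obtain ⟨a, -, ha⟩ := Submodule.mem_span_finset.1
    (show (1 : B) ∈ Submodule.span B (T : Set B) from (Ideal.eq_top_iff_one _).1 hT1)
  refine ⟨_, isBoundedSubset_linearCombinations T (fun t => v (a t)) hSb, fun k => ?_⟩
  have hlift : ∀ t ∈ T, ∃ y ∈ S, π y = u (const _ t * var _ i ^ k) := by
    intro t ht
    have : const (Weights.one B n) t * var _ i ^ k ∈ restrictedNhd (Weights.one B n) U := by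
      have h2 : const (Weights.one B n) t * var _ i ^ k = var _ i ^ k * const _ t := mul_comm _ _
      rw [h2]
      have h3 : ∀ k, ∀ p ∈ restrictedNhd (Weights.one B n) U,
          var _ i ^ k * p ∈ restrictedNhd (Weights.one B n) U := by
        intro k
        induction k with
        | zero => intro p hp; rwa [pow_zero, one_mul]
        | succ k ih =>
          intro p hp
          rw [pow_succ, mul_assoc]
          refine ih _ (mul_mem_restrictedNhd (fun ν => ?_) hp)
          classical
          rw [← mono_single_eq_var, coeff_mono]
          split_ifs with h
          · rw [h, Weights.pow_single]
            exact Submodule.subset_span (by simp [Weights.one])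
          · exact Submodule.zero_mem _
      refine h3 k _ ?_
      rw [← mono_zero_eq_const]
      exact mono_mem_restrictedNhd (by rw [Weights.pow_zero, one_mul]; exact hT ht)
    obtain ⟨y, hy, h⟩ := hU this
    exact ⟨y, hy, h⟩
  choose! y hyS hy using hlift
  refine ⟨_, ⟨y, hyS, rfl⟩, ?_⟩
  rw [map_sum]
  have h2 : ∀ b, π (v b) = u (const _ b) := fun b => RingHom.congr_fun huv b
  conv_rhs => rw [← one_mul (u _ ^ k), ← map_one u, ← map_one (const (Weights.one B n)), ← ha,
    map_sum, map_sum, Finset.sum_mul]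
  refine Finset.sum_congr rfl fun t ht => ?_
  rw [map_mul, hy t ht, h2, smul_eq_mul, map_mul, map_mul, map_mul, map_pow]
  ring

end PowerBounded

/-! ### Infinitesimal lifting -/

section Lifting

/-- `φ : B → C'` has the infinitesimal lifting property for topological square-zero extensions
`π : E → C` of complete rings with a bounded neighbourhood of `0`. -/
def HasLifts {B C' : Type u} [CommRing B] [TopologicalSpace B] [CommRing C'] [TopologicalSpace C']
    (φ : B →+* C') : Prop :=
  ∀ (E C : Type u) [CommRing E] [TopologicalSpace E] [NonarchimedeanRing E] [T2Space E]
    [CommRing C] [TopologicalSpace C] [NonarchimedeanRing C] [T2Space C]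
    (π : E →+* C) (u : C' →+* C) (v : B →+* E),
    IsCompleteGroup E → (∃ S ∈ 𝓝 (0 : E), IsBoundedSubset S) → IsOpenQuotientMap π →
    (∀ x ∈ RingHom.ker π, ∀ y ∈ RingHom.ker π, x * y = 0) →
    Continuous u → Continuous v → π.comp v = u.comp φ →
    ∃ w : C' →+* E, Continuous w ∧ π.comp w = u ∧ w.comp φ = v

lemma HasLifts.comp {B C D : Type u} [CommRing B] [TopologicalSpace B] [CommRing C]
    [TopologicalSpace C] [CommRing D] [TopologicalSpace D] {φ : B →+* C} {ψ : C →+* D}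
    (hψ : HasLifts ψ) (hφ : HasLifts φ) (hc : Continuous ψ) : HasLifts (ψ.comp φ) := by
  intro E C' _ _ _ _ _ _ _ _ π u v hE hS hπ hsq hu hv huv
  obtain ⟨w₁, hw₁, h₁, h₁'⟩ := hφ E C' π (u.comp ψ) v hE hS hπ hsq (hu.comp hc) hv huv
  obtain ⟨w₂, hw₂, h₂, h₂'⟩ := hψ E C' π u w₁ hE hS hπ hsq hu hw₁ h₁
  exact ⟨w₂, hw₂, h₂, by rw [← RingHom.comp_assoc, h₂', h₁']⟩

lemma isUnit_of_isUnit_map {E C : Type*} [CommRing E] [CommRing C] {π : E →+* C}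
    (hπ : Function.Surjective π) (hsq : ∀ x ∈ RingHom.ker π, ∀ y ∈ RingHom.ker π, x * y = 0)
    {x : E} (hx : IsUnit (π x)) : IsUnit x := by
  obtain ⟨c, hc⟩ := hx.exists_right_inv
  obtain ⟨y, rfl⟩ := hπ c
  have h : x * y - 1 ∈ RingHom.ker π := by
    rw [RingHom.mem_ker, map_sub, map_mul, hc, map_one, sub_self]
  have h2 := hsq _ h _ h
  exact IsUnit.of_mul_eq_one (y * (2 - x * y)) (by linear_combination -h2)

lemma RationalDatum.isUnit_map_den {R S : Type u} [CommRing R] [CommRing S] (D : RationalDatum R)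
    (φ : R →+* S) {x : Fin D.n → S} (h : ∀ i, φ D.den * x i = φ (D.num i)) :
    IsUnit (φ D.den) := by
  have h1 := congrArg (Ideal.map φ) D.span_eq_top
  rw [Ideal.map_span, Ideal.map_top] at h1
  rw [← Ideal.span_singleton_eq_top, eq_top_iff, ← h1, Ideal.span_le]
  rintro _ ⟨_, (rfl | ⟨i, rfl⟩), rfl⟩
  · exact Ideal.mem_span_singleton_self _
  · exact Ideal.mem_span_singleton.2 ⟨x i, (h i).symm⟩

lemma IsRationalLocalizationAt.hasLifts {B C' : RingPair.{u}} {D : RationalDatum B}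
    {φ : B →+* C'} (h : IsRationalLocalizationAt D φ) (hB : IsAnalyticRing B) : HasLifts φ := by
  obtain ⟨ψ, hψ, rfl, hker⟩ := h.exists_isOpenQuotientMap
  intro E C _ _ _ _ _ _ _ _ π u v hE ⟨S, hS, hSb⟩ hπ hsq hu hv huv
  have hrel : ∀ i, ψ (const _ D.den) * ψ (var _ i) = ψ (const _ (D.num i)) := fun i => by
    rw [← map_mul, ← sub_eq_zero, ← map_sub, ← RingHom.mem_ker, hker]
    exact subset_closure (Ideal.subset_span ⟨i, rfl⟩)
  have hπv : ∀ b, π (v b) = u (ψ (const _ b)) := fun b => RingHom.congr_fun huv b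
  have hunitC : IsUnit (π (v D.den)) := by
    rw [hπv]
    exact (D.isUnit_map_den (ψ.comp (const _)) hrel).map u
  have hunit : IsUnit (v D.den) := isUnit_of_isUnit_map hπ.surjective hsq hunitC
  obtain ⟨γ, hγ⟩ := hunit.exists_left_inv
  let e : Fin D.n → E := fun i => γ * v (D.num i)
  have he : ∀ i, v D.den * e i = v (D.num i) := fun i => by
    change v D.den * (γ * v (D.num i)) = _
    linear_combination (v (D.num i)) * hγ
  have hπe : ∀ i, π (e i) = u (ψ (var _ i)) := fun i => by
    refine hunitC.mul_left_cancel ?_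
    rw [← map_mul, he, hπv, hπv, ← map_mul, hrel]
  have hpb : ∀ i, IsPowerBounded (e i) := fun i => by
    obtain ⟨S', hS', h'⟩ := exists_bounded_lifts hB (u := u.comp ψ) (hu.comp hψ.continuous)
      hπ.isOpenMap huv hS hSb i
    refine isPowerBounded_of_lifts hsq hS' fun k => ?_
    obtain ⟨y, hy, h''⟩ := h' k
    exact ⟨y, hy, by rw [hπe]; exact h''⟩
  have hev : CanEvaluate (Weights.one B D.n) v e := fun W hW => by
    obtain ⟨V, hV, hVm⟩ := isBoundedSubset_monomials hpb W hW
    obtain ⟨U, hU⟩ := exists_openSubmod (hv.continuousAt.preimage_mem_nhds (x := 0)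
      (by rwa [map_zero]))
    refine ⟨U, fun ν a ha => hVm _ (hU ?_) _ ⟨ν, rfl⟩⟩
    have h1 : (Weights.one B D.n).pow ν = 1 := by
      simp [Weights.pow, Weights.one, ← Submodule.one_eq_span]
    rwa [h1, one_mul] at ha
  obtain ⟨w, hw, hwc, hwv⟩ := hev.exists_ringHom hE
  have hwc' : ∀ b, w (const _ b) = v b := fun b => RingHom.congr_fun hwc b
  have hle : RingHom.ker ψ ≤ RingHom.ker w := by
    intro p hp
    rw [hker] at hp
    refine closure_minimal (t := w ⁻¹' {0}) ?_ (isClosed_singleton.preimage hw) hp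
    refine (Ideal.span_le (I := RingHom.ker w)).2 ?_
    rintro _ ⟨i, rfl⟩
    change w _ = 0
    rw [map_sub, map_mul, hwc', hwc', hwv, he, sub_self]
  let w' : C' →+* E := RingHom.liftOfSurjective ψ hψ.surjective ⟨w, hle⟩
  have hw' : ∀ p, w' (ψ p) = w p := fun p =>
    RingHom.liftOfRightInverse_comp_apply _ _ _ ⟨w, hle⟩ p
  refine ⟨w', ?_, ?_, ?_⟩
  · rw [hψ.isQuotientMap.continuous_iff]
    have : w' ∘ ψ = w := funext hw'
    rwa [this]
  · refine RingHom.ext fun x => ?_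
    obtain ⟨p, rfl⟩ := hψ.surjective x
    change π (w' (ψ p)) = u (ψ p)
    rw [hw']
    refine mem_of_const_mem_of_var_mem (S := RingHom.eqLocus (π.comp w) (u.comp ψ))
      (isClosed_eq (hπ.continuous.comp hw) (hu.comp hψ.continuous)) (fun a => ?_) (fun i => ?_) p
    · change π (w (const _ a)) = u (ψ (const _ a))
      rw [hwc', hπv]
    · change π (w (var _ i)) = u (ψ (var _ i))
      rw [hwv, hπe]
  · refine RingHom.ext fun b => ?_
    change w' (ψ (const _ b)) = v b
    rw [hw', hwc']

/-- The algebraic lift is continuous because the target of `φ` has the module topology. -/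
lemma IsFiniteEtale.hasLifts {B C' : RingPair.{u}} {φ : B →+* C'} (h : IsFiniteEtale φ) :
    HasLifts φ := by
  intro E C _ _ _ _ _ _ _ _ π u v _ _ hπ hsq hu hv huv
  let := φ.toAlgebra
  let := v.toAlgebra
  let := (π.comp v).toAlgebra
  have : IsModuleTopology B C' := h.topology
  have : Algebra.Etale B C' := h.etale
  let u' : C' →ₐ[B] C := { u with commutes' := fun b => (RingHom.congr_fun huv b).symm }
  let π' : E →ₐ[B] C := { π with commutes' := fun b => rfl }
  have hnil : IsNilpotent (RingHom.ker (π' : E →+* C)) := by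
    refine ⟨2, ?_⟩
    rw [pow_two, Ideal.zero_eq_bot, eq_bot_iff, Ideal.mul_le]
    exact fun x hx y hy => hsq x hx y hy
  let w := Algebra.FormallySmooth.liftOfSurjective u' π' hπ.surjective hnil
  refine ⟨w, ?_, ?_, ?_⟩
  · refine IsModuleTopology.continuous_of_ringHom (R := B) (w : C' →+* E) ?_
    have : (w : C' →+* E).comp (algebraMap B C') = v := w.comp_algebraMap
    rwa [this]
  · refine RingHom.ext fun x => ?_
    exact Algebra.FormallySmooth.liftOfSurjective_apply u' π' hπ.surjective hnil x
  · exact w.comp_algebraMap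

lemma IsComposite.hasLifts {B C : RingPair.{u}} {φ : B →+* C} (h : IsComposite φ)
    (hB : IsAnalyticRing B) : HasLifts φ := by
  induction h with
  | rational h =>
    obtain ⟨D, hD⟩ := h
    exact hD.hasLifts hB
  | finiteEtale h => exact h.hasLifts
  | comp h₁ h₂ ih₁ ih₂ => exact (ih₂ (hB.map h₁.continuous)).comp (ih₁ hB) h₂.continuous

end Lifting

/-! ### Continuous derivations -/

section Derivations

/-- Continuous derivations along `φ : B → C` vanish; their targets are rings, regarded as
`C`-modules through a ring homomorphism. -/
def HasNoDerivations {B C : Type u} [CommRing B] [CommRing C] [TopologicalSpace C]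
    (φ : B →+* C) : Prop :=
  ∀ (M : Type u) [CommRing M] [TopologicalSpace M] [T2Space M] (θ : C →+* M) (d : C →+ M),
    Continuous d → (∀ x y, d (x * y) = θ x * d y + θ y * d x) → (∀ b, d (φ b) = 0) →
    ∀ x, d x = 0

lemma HasNoDerivations.comp {B C D : Type u} [CommRing B] [CommRing C] [TopologicalSpace C]
    [CommRing D] [TopologicalSpace D] {φ : B →+* C} {ψ : C →+* D} (hψ : HasNoDerivations ψ)
    (hφ : HasNoDerivations φ) (hc : Continuous ψ) : HasNoDerivations (ψ.comp φ) := by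
  intro M _ _ _ θ d hd hmul h0
  refine hψ M θ d hd hmul (hφ M (θ.comp ψ) (d.comp (ψ : C →+ D)) (hd.comp hc) (fun x y => ?_) h0)
  simp [hmul]

lemma IsRationalLocalizationAt.hasNoDerivations {B C : RingPair.{u}} {D : RationalDatum B}
    {φ : B →+* C} (h : IsRationalLocalizationAt D φ) : HasNoDerivations φ := by
  obtain ⟨ψ, hψ, rfl, hker⟩ := h.exists_isOpenQuotientMap
  intro M _ _ _ θ d hd hmul h0 x
  have hrel : ∀ i, ψ (const _ D.den) * ψ (var _ i) = ψ (const _ (D.num i)) := fun i => by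
    rw [← map_mul, ← sub_eq_zero, ← map_sub, ← RingHom.mem_ker, hker]
    exact subset_closure (Ideal.subset_span ⟨i, rfl⟩)
  have hunit : IsUnit (θ (ψ (const _ D.den))) :=
    (D.isUnit_map_den (ψ.comp (const _)) hrel).map θ
  obtain ⟨p, rfl⟩ := hψ.surjective x
  have h0' : ∀ b, d (ψ (const _ b)) = 0 := h0
  let S : Subring (restricted (Weights.one B D.n)) :=
    { carrier := {p | d (ψ p) = 0}
      zero_mem' := by simp
      one_mem' := by
        change d (ψ 1) = 0
        rw [← map_one (const _), h0']
      add_mem' := fun {p q} hp hq => by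
        change d (ψ (p + q)) = 0
        rw [map_add, map_add, hp, hq, add_zero]
      neg_mem' := fun {p} hp => by
        change d (ψ (-p)) = 0
        rw [map_neg, map_neg, hp, neg_zero]
      mul_mem' := fun {p q} hp hq => by
        change d (ψ (p * q)) = 0
        rw [map_mul, hmul, hp, hq, mul_zero, mul_zero, add_zero] }
  refine mem_of_const_mem_of_var_mem (S := S) (isClosed_eq (hd.comp hψ.continuous)
    continuous_const) h0' (fun i => ?_) p
  change d (ψ (var _ i)) = 0
  refine hunit.mul_left_cancel ?_
  have h1 := hmul (ψ (const _ D.den)) (ψ (var _ i))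
  rw [hrel, h0', h0', mul_zero, add_zero] at h1
  rw [← h1, mul_zero]

lemma IsFiniteEtale.hasNoDerivations {B C : RingPair.{u}} {φ : B →+* C} (h : IsFiniteEtale φ) :
    HasNoDerivations φ := by
  intro M _ _ _ θ d _ hmul h0 x
  let := φ.toAlgebra
  let := θ.toAlgebra
  let := (θ.comp φ).toAlgebra
  have : IsScalarTower B C M := IsScalarTower.of_algebraMap_eq fun _ => rfl
  have : Algebra.Etale B C := h.etale
  have hlin : ∀ (b : B) (x : C), d (b • x) = b • d x := fun b x => by
    rw [Algebra.smul_def, Algebra.smul_def]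
    change d (φ b * x) = θ (φ b) * d x
    rw [hmul, h0, mul_zero, add_zero]
  let δ : Derivation B C M := Derivation.mk' { d with map_smul' := hlin } fun x y => by
    change d (x * y) = x • d y + y • d x
    rw [Algebra.smul_def, Algebra.smul_def]
    exact hmul x y
  have : δ x = 0 := by
    rw [← δ.liftKaehlerDifferential_comp_D,
      Subsingleton.elim (KaehlerDifferential.D B C x) 0, map_zero]
  exact this

lemma IsComposite.hasNoDerivations {B C : RingPair.{u}} {φ : B →+* C} (h : IsComposite φ) :
    HasNoDerivations φ := by
  induction h with
  | rational h =>
    obtain ⟨D, hD⟩ := h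
    exact hD.hasNoDerivations
  | finiteEtale h => exact h.hasNoDerivations
  | comp _ h₂ ih₁ ih₂ => exact ih₂.comp ih₁ h₂.continuous

end Derivations

/-! ### Quotient rings and Huber rings -/

section Quotients

open Filter

lemma isCompleteGroup_of_isOpenQuotientMap {P E : Type*} [CommRing P] [TopologicalSpace P]
    [IsTopologicalRing P] [FirstCountableTopology P] [CommRing E] [TopologicalSpace E]
    [IsTopologicalRing E] (hP : IsCompleteGroup P) {q : P →+* E} (hq : IsOpenQuotientMap q) :
    IsCompleteGroup E :=
  hP.of_isOpenQuotientMap (q : P →+ E) hq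

lemma t2Space_of_isOpenQuotientMap {P E : Type*} [CommRing P] [TopologicalSpace P]
    [CommRing E] [TopologicalSpace E] [IsTopologicalRing E] {q : P →+* E}
    (hq : IsOpenQuotientMap q) (hker : IsClosed (RingHom.ker q : Set P)) : T2Space E := by
  rw [IsTopologicalAddGroup.t2Space_iff_zero_closed, ← hq.isQuotientMap.isClosed_preimage]
  exact hker

lemma nonarchimedeanRing_of_isOpenQuotientMap {P E : Type*} [CommRing P] [TopologicalSpace P]
    [NonarchimedeanRing P] [CommRing E] [TopologicalSpace E] [IsTopologicalRing E] {q : P →+* E}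
    (hq : IsOpenQuotientMap q) : NonarchimedeanRing E where
  is_nonarchimedean U hU := by
    obtain ⟨V, hV⟩ := NonarchimedeanRing.is_nonarchimedean (q ⁻¹' U)
      (hq.continuous.continuousAt.preimage_mem_nhds (by rwa [map_zero]))
    refine ⟨⟨V.toAddSubgroup.map (q : P →+ E), hq.isOpenMap _ V.isOpen⟩, ?_⟩
    rintro _ ⟨p, hp, rfl⟩
    exact hV hp

lemma exists_bounded_nhd_of_isOpenQuotientMap {P E : Type u} [CommRing P] [TopologicalSpace P]
    [CommRing E] [TopologicalSpace E] {q : P →+* E} (hq : IsOpenQuotientMap q)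
    (hP : ∃ S ∈ 𝓝 (0 : P), IsBoundedSubset S) : ∃ S ∈ 𝓝 (0 : E), IsBoundedSubset S := by
  have himage : ∀ S ∈ 𝓝 (0 : P), q '' S ∈ 𝓝 (0 : E) := fun S hS => by
    have := hq.isOpenMap.image_mem_nhds hS
    rwa [map_zero] at this
  obtain ⟨S, hS, hb⟩ := hP
  refine ⟨q '' S, himage S hS, fun W hW => ?_⟩
  obtain ⟨V, hV, h⟩ := hb (q ⁻¹' W)
    (hq.continuous.continuousAt.preimage_mem_nhds (by rwa [map_zero]))
  refine ⟨q '' V, himage V hV, ?_⟩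
  rintro _ ⟨v, hv, rfl⟩ _ ⟨s, hs, rfl⟩
  rw [← map_mul]
  exact h v hv s hs

lemma exists_bounded_nhd_restricted {A : Type u} [CommRing A] [TopologicalSpace A]
    [NonarchimedeanRing A] (hA : HasBoundedOpenSubring A) {n : ℕ} (T : Weights A n) :
    ∃ S ∈ 𝓝 (0 : restricted T), IsBoundedSubset S := by
  obtain ⟨A₀, hA₀, hb⟩ := hA
  let U₀ : OpenSubmod A := ⟨AddSubgroup.toIntSubmodule A₀.toAddSubgroup, hA₀⟩
  refine ⟨restrictedNhd T U₀, (isOpen_restrictedNhd (T := T) U₀).mem_nhds (zero_mem _),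
    fun W hW => ?_⟩
  obtain ⟨U, -, hU⟩ := (restricted_hasBasis T).mem_iff.1 hW
  obtain ⟨V, hV, hVA⟩ := hb U.1 U.mem_nhds
  obtain ⟨V', hV'⟩ := exists_openSubmod hV
  have hVU : V'.1 * U₀.1 ≤ U.1 := Submodule.mul_le.2 fun v hv a ha => hVA v (hV' hv) a ha
  refine ⟨restrictedNhd T V', (isOpen_restrictedNhd (T := T) V').mem_nhds (zero_mem _),
    fun p hp q hq => hU fun ν => ?_⟩
  classical
  change MvPowerSeries.coeff ν (p.1 * q.1) ∈ T.pow ν * U.1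
  rw [MvPowerSeries.coeff_mul]
  refine Submodule.sum_mem _ fun x hx => ?_
  have hx' : x.1 + x.2 = ν := by simpa using hx
  rw [← hx', T.pow_add]
  have := Submodule.mul_mem_mul (hp x.1) (hq x.2)
  rw [mul_mul_mul_comm] at this
  exact mul_le_mul' le_rfl hVU this

lemma IsCompleteAnalyticHuber.hasBoundedOpenSubring {A : RingPair.{u}}
    (hA : IsCompleteAnalyticHuber A) : HasBoundedOpenSubring A := by
  obtain ⟨A₀, hA₀, J, -, hJ⟩ := hA.huber
  refine ⟨A₀, hA₀, fun W hW => ?_⟩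
  obtain ⟨k, -, hk⟩ := hJ.hasBasis_nhds_zero.mem_iff.1
    (continuous_subtype_val.continuousAt.preimage_mem_nhds (x := (0 : A₀)) hW)
  refine ⟨Subtype.val '' ((J ^ k : Ideal A₀) : Set A₀), ?_, ?_⟩
  · exact hA₀.isOpenMap_subtype_val.image_mem_nhds (x := (0 : A₀))
      (hJ.hasBasis_nhds_zero.mem_of_mem trivial)
  · rintro _ ⟨x, hx, rfl⟩ a ha
    exact hk ((J ^ k).mul_mem_right ⟨a, ha⟩ hx)

lemma IsCompleteAnalyticHuber.firstCountableTopology {A : RingPair.{u}}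
    (hA : IsCompleteAnalyticHuber A) : FirstCountableTopology A := by
  obtain ⟨A₀, hA₀, J, -, hJ⟩ := hA.huber
  have h0 : (𝓝 (0 : A)).IsCountablyGenerated := by
    have h1 : (𝓝 (0 : A₀)).IsCountablyGenerated := hJ.hasBasis_nhds_zero.isCountablyGenerated
    have h2 : map Subtype.val (𝓝 (0 : A₀)) = 𝓝 (0 : A) :=
      hA₀.isOpenEmbedding_subtypeVal.map_nhds_eq (0 : A₀)
    rw [← h2]
    infer_instance
  refine ⟨fun a => ?_⟩
  rw [← map_add_left_nhds_zero a]
  infer_instance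

lemma IsRationalLocalizationAt.t2Space_and_isCompleteGroup {A B : RingPair.{u}}
    (hA : IsCompleteAnalyticHuber A) {D : RationalDatum A} {φ : A →+* B}
    (h : IsRationalLocalizationAt D φ) : T2Space B ∧ IsCompleteGroup B := by
  have := hA.t2
  have := hA.firstCountableTopology
  obtain ⟨ψ, hψ, -, hker⟩ := h.exists_isOpenQuotientMap
  refine ⟨t2Space_of_isOpenQuotientMap hψ ?_,
    isCompleteGroup_of_isOpenQuotientMap (isCompleteGroup_restricted hA.complete) hψ⟩
  rw [hker]
  exact isClosed_closure

end Quotients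

/-! ### Vanishing of the cotangent complex -/

section Cotangent

variable {A : Type u} [CommRing A] [TopologicalSpace A] [NonarchimedeanRing A] {n : ℕ}
  {T : Weights A n}

lemma partialDeriv_const (i : Fin n) (a : A) : partialDeriv T i (const T a) = 0 :=
  Subtype.ext MvPowerSeries.pderiv_C

lemma partialDeriv_var_self (i : Fin n) : partialDeriv T i (var T i) = 1 :=
  Subtype.ext MvPowerSeries.pderiv_X_self

lemma partialDeriv_var_of_ne {i j : Fin n} (h : j ≠ i) : partialDeriv T i (var T j) = 0 :=
  Subtype.ext (MvPowerSeries.pderiv_X_of_ne h)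

/-- `∂/∂Xᵢ` as an additive map. -/
noncomputable def partialDerivHom (T : Weights A n) (i : Fin n) : restricted T →+ restricted T :=
  AddMonoidHom.mk' (partialDeriv T i) (partialDeriv_add T i)

lemma partialDerivHom_apply (i : Fin n) (p : restricted T) :
    partialDerivHom T i p = partialDeriv T i p := rfl

/-- The chain rule `dp = ∑ (∂p/∂Xᵢ) dXᵢ` for continuous derivations trivial on constants. -/
lemma derivation_eq_sum {E : Type u} [CommRing E] [TopologicalSpace E] [IsTopologicalRing E]
    [T2Space E] {q : restricted T →+* E} (hq : Continuous q) {d : restricted T →+ E}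
    (hd : Continuous d) (hmul : ∀ x y, d (x * y) = q x * d y + q y * d x)
    (hconst : ∀ a, d (const T a) = 0) (p : restricted T) :
    d p = ∑ i, q (partialDeriv T i p) * d (var T i) := by
  let s : restricted T →+ E := ∑ i, (AddMonoidHom.mulRight (d (var T i))).comp
    ((q : restricted T →+ E).comp (partialDerivHom T i))
  have hs : ∀ p, s p = ∑ i, q (partialDeriv T i p) * d (var T i) := fun p => by
    simp [s, partialDerivHom_apply]
  have hs_mul : ∀ x y, s (x * y) = q x * s y + q y * s x := fun x y => by
    rw [hs, hs, hs, Finset.mul_sum, Finset.mul_sum, ← Finset.sum_add_distrib]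
    refine Finset.sum_congr rfl fun i _ => ?_
    rw [partialDeriv_mul, map_add, map_mul, map_mul]
    ring
  have hs_cont : Continuous s := by
    have : (s : restricted T → E) = fun p => ∑ i, q (partialDeriv T i p) * d (var T i) :=
      funext hs
    rw [this]
    exact continuous_finsetSum _ fun i _ =>
      (hq.comp (continuous_partialDeriv T i)).mul continuous_const
  have hs_const : ∀ a, s (const T a) = 0 := fun a => by
    rw [hs]
    exact Finset.sum_eq_zero fun i _ => by rw [partialDeriv_const, map_zero, zero_mul]
  have hs_var : ∀ j, s (var T j) = d (var T j) := fun j => by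
    rw [hs, Finset.sum_eq_single j]
    · rw [partialDeriv_var_self, map_one, one_mul]
    · intro i _ hij
      rw [partialDeriv_var_of_ne hij.symm, map_zero, zero_mul]
    · simp
  let S : Subring (restricted T) :=
    { carrier := {p | d p = s p}
      zero_mem' := by simp
      one_mem' := by
        change d 1 = s 1
        rw [← map_one (const T), hconst, hs_const]
      add_mem' := fun {x y} hx hy => by
        change d (x + y) = s (x + y)
        rw [map_add, map_add, hx, hy]
      neg_mem' := fun {x} hx => by
        change d (-x) = s (-x)
        rw [map_neg, map_neg, hx]
      mul_mem' := fun {x y} hx hy => by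
        change d (x * y) = s (x * y)
        rw [hmul, hs_mul, hx, hy] }
  rw [← hs]
  exact mem_of_const_mem_of_var_mem (S := S) (isClosed_eq hd hs_cont)
    (fun a => (hconst a).trans (hs_const a).symm) (fun j => (hs_var j).symm) p

lemma partialDeriv_mem_of_mem_closure {I : Ideal (restricted T)}
    (hI : IsClosed (I : Set (restricted T))) {p : restricted T} (hpI : p ∈ I)
    (hp : p ∈ (I ^ 2).closure) (i : Fin n) : partialDeriv T i p ∈ I := by
  have h : (⟨p, hpI⟩ : I) ∈ closureSq T I := hp
  exact Ideal.Quotient.eq_zero_iff_mem.1 (congrFun (closureSq_le_ker T I hI h) i)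

/-- A splitting of `P / cl(I²) → C` provides elements `fⱼ` of `I` such that
`p ≡ ∑ (∂p/∂Xⱼ) fⱼ` modulo `cl(I²)` for all `p ∈ I`. -/
lemma exists_forall_sub_sum_mem [T2Space A] [FirstCountableTopology A] (hA : IsCompleteGroup A)
    (hA₀ : HasBoundedOpenSubring A) {C : Type u} [CommRing C] [TopologicalSpace C]
    [NonarchimedeanRing C] [T2Space C] {ψ : restricted T →+* C} (hψ : IsOpenQuotientMap ψ)
    (hI : IsClosed (RingHom.ker ψ : Set (restricted T)))
    (hlift : HasLifts (ψ.comp (const T))) :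
    ∃ f : Fin n → restricted T, (∀ j, ψ (f j) = 0) ∧ ∀ p, ψ p = 0 →
      p - ∑ j, partialDeriv T j p * f j ∈ ((RingHom.ker ψ) ^ 2).closure := by
  set I := RingHom.ker ψ with hIdef
  let J : Ideal (restricted T) := (I ^ 2).closure
  let E := restricted T ⧸ J
  let q : restricted T →+* E := Ideal.Quotient.mk J
  have hq : IsOpenQuotientMap q := QuotientRing.isOpenQuotientMap_mk J
  have hqker : RingHom.ker q = J := Ideal.mk_ker
  have hJI : J ≤ I := fun p hp => closure_minimal (Ideal.pow_le_self two_ne_zero) hI hp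
  -- The square-zero extension `P / cl(I²) → C`, to which the lifting property applies.
  let π : E →+* C := Ideal.Quotient.lift J ψ fun p hp => hJI hp
  have hπq : ∀ p, π (q p) = ψ p := fun p => Ideal.Quotient.lift_mk J ψ _
  have hπ : IsOpenQuotientMap π := by
    refine ⟨fun c => ?_, ?_, fun U hU => ?_⟩
    · obtain ⟨p, rfl⟩ := hψ.surjective c
      exact ⟨q p, hπq p⟩
    · rw [← hq.continuous_comp_iff]
      have : π ∘ q = ψ := funext hπq
      rw [this]
      exact hψ.continuous
    · have : π '' U = ψ '' (q ⁻¹' U) := by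
        have h1 : π ∘ q = ψ := funext hπq
        rw [← h1, Set.image_comp, Set.image_preimage_eq _ hq.surjective]
      rw [this]
      exact hψ.isOpenMap _ (hU.preimage hq.continuous)
  have hsq : ∀ x ∈ RingHom.ker π, ∀ y ∈ RingHom.ker π, x * y = 0 := by
    intro x hx y hy
    obtain ⟨x, rfl⟩ := hq.surjective x
    obtain ⟨y, rfl⟩ := hq.surjective y
    rw [RingHom.mem_ker, hπq] at hx hy
    rw [← map_mul, ← RingHom.mem_ker, hqker]
    refine subset_closure ?_
    rw [pow_two]
    exact Ideal.mul_mem_mul hx hy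
  have : NonarchimedeanRing E := nonarchimedeanRing_of_isOpenQuotientMap hq
  have : T2Space E := t2Space_of_isOpenQuotientMap hq (by rw [hqker]; exact isClosed_closure)
  have hE : IsCompleteGroup E :=
    isCompleteGroup_of_isOpenQuotientMap (isCompleteGroup_restricted hA) hq
  obtain ⟨w, hw, hπw, hwc⟩ := hlift E C π (RingHom.id C) (q.comp (const T)) hE
    (exists_bounded_nhd_of_isOpenQuotientMap hq (exists_bounded_nhd_restricted hA₀ T)) hπ hsq
    continuous_id (hq.continuous.comp continuous_constHom) (RingHom.ext fun a => hπq _)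
  have hπw' : ∀ c, π (w c) = c := fun c => RingHom.congr_fun hπw c
  -- The difference of the two maps `P → E` over `C` is a derivation, as `E → C` is square-zero.
  let d : restricted T →+ E := (q : restricted T →+ E) - (w.comp ψ : restricted T →+* E)
  have hd : ∀ p, d p = q p - w (ψ p) := fun p => rfl
  have hdker : ∀ p, d p ∈ RingHom.ker π := fun p => by
    rw [RingHom.mem_ker, hd, map_sub, hπq, hπw', sub_self]
  have hdI : ∀ p, ψ p = 0 → d p = q p := fun p hp => by rw [hd, hp, map_zero, sub_zero]
  have hchain := derivation_eq_sum (q := q) hq.continuous (d := d)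
    (hq.continuous.sub (hw.comp hψ.continuous))
    (fun x y => by
      have h1 := hsq _ (hdker x) _ (hdker y)
      rw [hd, hd] at h1
      rw [hd, hd, hd, map_mul, map_mul, map_mul]
      linear_combination -h1)
    (fun a => by
      rw [hd, sub_eq_zero]
      exact (RingHom.congr_fun hwc a).symm)
  choose f hf using fun j => hq.surjective (d (var T j))
  refine ⟨f, fun j => ?_, fun p hp => ?_⟩
  · rw [← hπq, hf]
    exact hdker _
  · change _ ∈ J
    rw [← hqker, RingHom.mem_ker, map_sub, ← hdI p hp, hchain, map_sum, sub_eq_zero]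
    refine Finset.sum_congr rfl fun j _ => ?_
    rw [map_mul, hf]

/-- If `A → C` has infinitesimal liftings and no continuous derivations, the differential
`I / cl(I²) → ⨁ C dXᵢ` is bijective: a splitting of `P / cl(I²) → C` gives an inverse. -/
theorem conormalMap_bijective [T2Space A] [FirstCountableTopology A] (hA : IsCompleteGroup A)
    (hA₀ : HasBoundedOpenSubring A) {C : Type u} [CommRing C] [TopologicalSpace C]
    [NonarchimedeanRing C] [T2Space C] {ψ : restricted T →+* C} (hψ : IsOpenQuotientMap ψ)
    (hI : IsClosed (RingHom.ker ψ : Set (restricted T)))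
    (hlift : HasLifts (ψ.comp (const T))) (hder : HasNoDerivations (ψ.comp (const T))) :
    Function.Bijective (conormalMap T (RingHom.ker ψ) hI) := by
  obtain ⟨f, hf, hsum⟩ := exists_forall_sub_sum_mem hA hA₀ hψ hI hlift
  have key : ∀ i j, ψ (partialDeriv T i (f j)) = if j = i then 1 else 0 := by
    intro i
    -- The derivation `p ↦ ∂ᵢp - ∑ⱼ ∂ⱼp · ∂ᵢfⱼ` kills `I`, so it descends to `C`, where it is zero.
    let e : restricted T →+ C := (ψ : restricted T →+ C).comp (partialDerivHom T i) -
      ∑ j, (AddMonoidHom.mulRight (ψ (partialDeriv T i (f j)))).comp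
        ((ψ : restricted T →+ C).comp (partialDerivHom T j))
    have he : ∀ p, e p = ψ (partialDeriv T i p) -
        ∑ j, ψ (partialDeriv T j p) * ψ (partialDeriv T i (f j)) := fun p => by
      simp [e, partialDerivHom_apply]
    have hec : Continuous e := by
      have : (e : restricted T → C) = fun p => ψ (partialDeriv T i p) -
          ∑ j, ψ (partialDeriv T j p) * ψ (partialDeriv T i (f j)) := funext he
      rw [this]
      exact (hψ.continuous.comp (continuous_partialDeriv T i)).sub
        (continuous_finsetSum _ fun j _ =>
          (hψ.continuous.comp (continuous_partialDeriv T j)).mul continuous_const)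
    have heI : ∀ p, ψ p = 0 → e p = 0 := by
      intro p hp
      have h1 : p - ∑ j, partialDeriv T j p * f j ∈ RingHom.ker ψ := by
        rw [RingHom.mem_ker, map_sub, hp, map_sum, zero_sub, neg_eq_zero]
        exact Finset.sum_eq_zero fun j _ => by rw [map_mul, hf, mul_zero]
      have h2 : ψ (partialDeriv T i (p - ∑ j, partialDeriv T j p * f j)) = 0 :=
        partialDeriv_mem_of_mem_closure hI h1 (hsum p hp) i
      rw [← partialDerivHom_apply, map_sub, map_sum, map_sub, map_sum] at h2
      rw [he, ← h2]
      congr 1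
      refine Finset.sum_congr rfl fun j _ => ?_
      rw [partialDerivHom_apply, partialDeriv_mul, map_add, map_mul, map_mul, hf, zero_mul,
        add_zero]
    let e' : C →+ C := AddMonoidHom.liftOfSurjective (ψ : restricted T →+ C) hψ.surjective
      ⟨e, heI⟩
    have he' : ∀ p, e' (ψ p) = e p := fun p =>
      AddMonoidHom.liftOfRightInverse_comp_apply (ψ : restricted T →+ C) _ _ ⟨e, heI⟩ p
    have hzero : ∀ x, e' x = 0 := by
      refine hder C (RingHom.id C) e' ?_ (fun x y => ?_) fun a => ?_
      · rw [← hψ.continuous_comp_iff]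
        have : e' ∘ ψ = e := funext he'
        rwa [this]
      · obtain ⟨p, rfl⟩ := hψ.surjective x
        obtain ⟨r, rfl⟩ := hψ.surjective y
        rw [← map_mul, he', he', he', he, he, he]
        simp only [partialDeriv_mul, map_add, map_mul, add_mul, Finset.sum_add_distrib,
          RingHom.id_apply, mul_sub, Finset.mul_sum, mul_assoc]
        ring
      · change e' (ψ (const T a)) = 0
        rw [he', he]
        simp [partialDeriv_const]
    intro j
    have h := hzero (ψ (var T j))
    rw [he', he, Finset.sum_eq_single j, partialDeriv_var_self, map_one, one_mul,
      sub_eq_zero] at h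
    · rw [← h]
      split_ifs with hij
      · rw [hij, partialDeriv_var_self, map_one]
      · rw [partialDeriv_var_of_ne hij, map_zero]
    · intro k _ hk
      rw [partialDeriv_var_of_ne hk.symm, map_zero, zero_mul]
    · simp
  constructor
  · rw [← LinearMap.ker_eq_bot]
    refine Submodule.ker_liftQ_eq_bot _ _ _ fun p hp => ?_
    have h1 : ∀ i, partialDeriv T i p.1 ∈ RingHom.ker ψ := fun i =>
      Ideal.Quotient.eq_zero_iff_mem.1 (congrFun hp i)
    change p.1 ∈ ((RingHom.ker ψ) ^ 2).closure
    have h2 := hsum p.1 p.2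
    have h3 : ∑ j, partialDeriv T j p.1 * f j ∈ ((RingHom.ker ψ) ^ 2).closure := by
      refine subset_closure (Ideal.sum_mem _ fun j _ => ?_)
      rw [pow_two]
      exact Ideal.mul_mem_mul (h1 j) (hf j)
    simpa using Ideal.add_mem _ h2 h3
  · intro g
    choose r hr using fun j => Ideal.Quotient.mk_surjective (g j)
    let x : RingHom.ker ψ := ∑ j, r j • ⟨f j, hf j⟩
    refine ⟨(closureSq T (RingHom.ker ψ)).mkQ x, ?_⟩
    change idealDifferential T (RingHom.ker ψ) x = g
    rw [map_sum]
    ext i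
    rw [Finset.sum_apply]
    have h1 : ∀ j, idealDifferential T (RingHom.ker ψ) (r j • ⟨f j, hf j⟩) i =
        if j = i then g i else 0 := by
      intro j
      have h2 : Ideal.Quotient.mk (RingHom.ker ψ) (partialDeriv T i (f j)) =
          if j = i then 1 else 0 := by
        have h3 : partialDeriv T i (f j) - (if j = i then 1 else 0) ∈ RingHom.ker ψ := by
          rw [RingHom.mem_ker, map_sub, key, sub_eq_zero]
          split_ifs
          · rw [map_one]
          · rw [map_zero]
        have h4 := (Ideal.Quotient.eq).2 h3
        rw [h4]
        split_ifs
        · rw [map_one]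
        · rw [map_zero]
      rw [map_smul, Pi.smul_apply]
      change r j • Ideal.Quotient.mk (RingHom.ker ψ) (partialDeriv T i (f j)) = _
      rw [h2, Algebra.smul_def]
      change Ideal.Quotient.mk (RingHom.ker ψ) (r j) * _ = _
      rw [hr]
      split_ifs with hij
      · rw [hij, mul_one]
      · rw [mul_zero]
    simp [h1]

open CategoryTheory Limits

open scoped ZeroObject in
/-- A complex concentrated in two consecutive degrees is quasi-isomorphic to zero if its
differential is an isomorphism. -/
lemma quasiIso_zero_double {R : Type u} [CommRing R] {X Y : ModuleCat.{u} R} (φ : X ⟶ Y)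
    [IsIso φ] :
    QuasiIso (0 : HomologicalComplex.double (c := ComplexShape.down ℕ) (i₀ := 1) (i₁ := 0) φ rfl ⟶
      (0 : ChainComplex (ModuleCat.{u} R) ℕ)) := by
  let K := HomologicalComplex.double (c := ComplexShape.down ℕ) (i₀ := 1) (i₁ := 0) φ rfl
  refine ⟨fun i => ?_⟩
  have hzero : ((0 : ChainComplex (ModuleCat.{u} R) ℕ)).ExactAt i :=
    .of_isZero ((HomologicalComplex.eval _ _ i).map_isZero (isZero_zero _))
  rw [quasiIsoAt_iff_exactAt' _ _ hzero]
  have hd : K.d 1 0 = (HomologicalComplex.doubleXIso₀ φ _).hom ≫ φ ≫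
      (HomologicalComplex.doubleXIso₁ φ _ one_ne_zero).inv :=
    HomologicalComplex.double_d φ _ one_ne_zero
  have : IsIso (K.d 1 0) := by
    rw [hd]
    infer_instance
  match i with
  | 0 =>
    rw [HomologicalComplex.exactAt_iff' _ 1 0 0 (by simp) (by simp)]
    refine (ShortComplex.exact_iff_epi _ (HomologicalComplex.shape K 0 0 (by simp))).2 ?_
    change Epi (K.d 1 0)
    infer_instance
  | 1 =>
    rw [HomologicalComplex.exactAt_iff' _ 2 1 0 (by simp) (by simp)]
    refine (ShortComplex.exact_iff_mono _ (HomologicalComplex.double_d_eq_zero₀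
      (c := ComplexShape.down ℕ) φ rfl _ _ (by simp))).2 ?_
    change Mono (K.d 1 0)
    infer_instance
  | k + 2 => exact .of_isZero (HomologicalComplex.isZero_double_X φ rfl (k + 2) (by lia) (by lia))

/-- Composites of rational localizations and finite étale morphisms have vanishing truncated
cotangent complex. -/
theorem IsComposite.cotangentComplexVanishes {A C : RingPair.{u}}
    (hA : IsCompleteAnalyticHuber A) {f : A →+* C} (hf : IsComposite f) [T2Space C]
    (hC : IsCompleteGroup C) : CotangentComplexVanishes f := by
  have := hA.t2
  have := hA.firstCountableTopology
  have hA₀ := hA.hasBoundedOpenSubring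
  refine ⟨?_, fun P => ?_⟩
  · obtain ⟨n, T, c, hT⟩ := hf.isTopFiniteType hA.analytic hA₀ (f := RingHom.id A) continuous_id
      IsTopFiniteType.id
    obtain ⟨ψ, hψ, hc⟩ := IsTopGen.exists_isOpenQuotientMap hA.complete hC hT
    exact ⟨{
      n := n
      weights := T
      map := ψ
      map_const := hc
      continuous := hψ.continuous
      isOpenMap := hψ.isOpenMap
      surjective := hψ.surjective
      isClosed_ker := isClosed_singleton.preimage hψ.continuous }⟩
  · have hb : Function.Bijective (conormalMap P.weights (RingHom.ker P.map) P.isClosed_ker) := by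
      refine conormalMap_bijective (C := C) hA.complete hA₀
        ⟨P.surjective, P.continuous, P.isOpenMap⟩
        P.isClosed_ker ?_ ?_
      · rw [P.map_const]
        exact hf.hasLifts hA.analytic
      · rw [P.map_const]
        exact hf.hasNoDerivations
    have : IsIso (ModuleCat.ofHom (conormalMap P.weights (RingHom.ker P.map) P.isClosed_ker)) :=
      (LinearEquiv.ofBijective _ hb).toModuleIso.isIso_hom
    exact quasiIso_zero_double _

end Cotangent

end NaiveEtale

/-- For a naive étale morphism of complete analytic uniform Huber pairs, the truncated topological
cotangent complex is quasi-isomorphic to zero locally for the rational topology. -/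
theorem mainTheorem3 (A B : NaiveEtale.RingPair.{u})
    (hA : NaiveEtale.IsCompleteAnalyticHuber A) (hA' : NaiveEtale.IsUniform A)
    (hB : NaiveEtale.IsCompleteAnalyticHuber B) (hB' : NaiveEtale.IsUniform B)
    (f : A →+* B) (hf : NaiveEtale.IsNaiveEtale f) :
    ∃ 𝒰 : NaiveEtale.RationalCovering B,
      ∀ j, NaiveEtale.CotangentComplexVanishes ((𝒰.map j).comp f) := by
  obtain ⟨𝒰, h𝒰⟩ := hf.locally_composite
  refine ⟨𝒰, fun j => ?_⟩
  obtain ⟨hT2, hC⟩ := (𝒰.isLocalization j).t2Space_and_isCompleteGroup hB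
  exact (h𝒰 j).cotangentComplexVanishes hA hC
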